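/- **Lemma 5.2 (convex domains $\mathcal D_g(r)$).** Let $d\ge 1$ and let $\mathcal O\subset\mathbb R^d$ be a bounded domain (nonempty, open, connected) with smooth boundary. Let $a=(a_{ij})$ be a matrix of functions of class $C^1$ on $\bar{\mathcal O}$, symmetric at each point of $\bar{\mathcal O}$ and uniformly elliptic: for some $a_0>0$, $\langle a(\xi)\eta,\eta\rangle\ge a_0|\eta|^2$ for all $\xi\in\bar{\mathcal O}$, $\eta\in\mathbb R^d$. Let $H=L^2(\mathcal O)$ (real valued, Lebesgue measure), and let $A$ be the realization in $H$ of the divergence type operator $\mathcal A=\sum_{i,j}\partial_i(a_{ij}\partial_j)$ with conormal boundary condition $\langle a\nu,\nabla h\rangle=0$ on $\partial\mathcal O$, that is: $u\in D(A)$ and $Au=f$ if and only if $u\in H^1(\mathcal O)$, $f\in H$ and $\int_{\mathcal O}\langle a\nabla u,\nabla v\rangle\,d\xi=-\int_{\mathcal O}fv\,d\xi$ for all $v\in H^1(\mathcal O)$. Let $\mu=|\mathcal O|^{-1}\lambda_d$ be the normalized Lebesgue measure on $\mathcal O$ and $\langle x,\mu\rangle=\int_{\mathcal O}x\,d\mu$,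 which is also regarded as a constant function in $H$. Let $g:\mathbb R\to\mathbb R$ be of class $C^2$, convex, and of quadratic growth at infinity: there are $c>0$ and $C,R\in\mathbb R$ with $c\,s^2\le g(s)\le C s^2$ whenever $|s|\ge R$. For $x\in H$ put $G(x)=\int_{\mathcal O}g(x(\xi))\,d\xi$, and for $r\in\mathbb R$ put $\mathcal D_g(r)=\{x\in H: G(x)<r\}$. Then $A$ is the generator of exactly one strongly continuous semigroup $e^{tA}$, $t\ge0$, on $H$; the function $g\circ x$ is integrable on $\mathcal O$ for every $x\in H$; and for every $r>g(0)|\mathcal O|$ the set $\mathcal D_g(r)$ is convex and - is open, bounded and connected in $H$ (equivalently in $L^2(\mathcal O,\mu)$, which is the same space with a multiple of the norm), - contains $0$, - is invariant under the semigroup: $e^{tA}x\in\mathcal D_g(r)$ for all $x\in\mathcal D_g(r)$ and $t\ge0$, - contains the constant function $\langle x,\mu\rangle$ for every $x\in\mathcal D_g(r)$. -/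

import Mathlib

open MeasureTheory Filter Topology
open scoped NNReal ContDiff

namespace NeumannExit

/-- `O` is a bounded domain in `ℝ^d`: a nonempty, connected, open and bounded set. -/
structure IsBoundedDomain {d : ℕ} (O : Set (EuclideanSpace ℝ (Fin d))) : Prop where
  isOpen : IsOpen O
  isConnected : IsConnected O
  isBounded : Bornology.IsBounded O

/-- The boundary of `O` is smooth: near each of its points, `O` is the region where a smooth
function with nonvanishing differential is negative. -/
def HasSmoothBoundary {d : ℕ} (O : Set (EuclideanSpace ℝ (Fin d))) : Prop :=
  ∀ p ∈ frontier O, ∃ (U : Set (EuclideanSpace ℝ (Fin d))) (ψ : EuclideanSpace ℝ (Fin d) → ℝ),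
    IsOpen U ∧ p ∈ U ∧ ContDiffOn ℝ ∞ ψ U ∧ fderiv ℝ ψ p ≠ 0 ∧
      ∀ ξ ∈ U, ξ ∈ O ↔ ψ ξ < 0

/-- Standing assumptions on the coefficients of the divergence type operator
`𝒜 = ∑ i j, ∂_i (a_ij ∂_j)`: the entries are `C¹` up to the boundary, and the matrix `a ξ` is
symmetric and uniformly elliptic on the closure of `O`. -/
structure IsEllipticCoefficient {d : ℕ} (O : Set (EuclideanSpace ℝ (Fin d)))
    (a : EuclideanSpace ℝ (Fin d) → Matrix (Fin d) (Fin d) ℝ) : Prop where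
  contDiffOn : ∀ i j, ContDiffOn ℝ 1 (fun ξ => a ξ i j) (closure O)
  isSymm : ∀ ξ ∈ closure O, (a ξ).IsSymm
  elliptic : ∃ a₀ : ℝ, 0 < a₀ ∧ ∀ ξ ∈ closure O, ∀ η : Fin d → ℝ,
    a₀ * ∑ i, η i ^ 2 ≤ ∑ i, ∑ j, a ξ i j * η i * η j

/-- The real Hilbert space `H = L²(O)` (Lebesgue measure on `O`). -/
abbrev L2 {d : ℕ} (O : Set (EuclideanSpace ℝ (Fin d))) : Type :=
  Lp ℝ 2 ((volume : Measure (EuclideanSpace ℝ (Fin d))).restrict O)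

/-- `w = (w_1, …, w_d) ∈ L²(O)^d` is the weak gradient of `u ∈ L²(O)`. Thus `u` belongs to the
Sobolev space `H¹(O)` if and only if it has a weak gradient in this sense. -/
def IsWeakGradient {d : ℕ} {O : Set (EuclideanSpace ℝ (Fin d))}
    (u : L2 O) (w : Fin d → L2 O) : Prop :=
  ∀ φ : EuclideanSpace ℝ (Fin d) → ℝ, ContDiff ℝ ∞ φ → HasCompactSupport φ → tsupport φ ⊆ O →
    ∀ i, ∫ ξ in O, u ξ * fderiv ℝ φ ξ (EuclideanSpace.single i 1) = - ∫ ξ in O, w i ξ * φ ξ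

/-- The graph of the operator `A`, the realization in `H = L²(O)` of `𝒜 = ∑ i j, ∂_i (a_ij ∂_j)`
with the conormal boundary condition `⟨a ν, ∇h⟩ = 0` on `∂O`:
`u ∈ D(A)` and `A u = f` if and only if `u ∈ H¹(O)` and
`∫_O ⟨a ∇u, ∇v⟩ = - ∫_O f v` for all `v ∈ H¹(O)`.
Taking `v` compactly supported in `O` gives `𝒜 u = f`; general `v` give the boundary condition. -/
def IsConormalRealization {d : ℕ} {O : Set (EuclideanSpace ℝ (Fin d))}
    (a : EuclideanSpace ℝ (Fin d) → Matrix (Fin d) (Fin d) ℝ) (u f : L2 O) : Prop :=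
  ∃ w : Fin d → L2 O, IsWeakGradient u w ∧
    ∀ (v : L2 O) (z : Fin d → L2 O), IsWeakGradient v z →
      ∫ ξ in O, ∑ i, ∑ j, a ξ i j * w j ξ * z i ξ = - ∫ ξ in O, f ξ * v ξ

/-- `S` is a strongly continuous semigroup of bounded linear operators on `X`. -/
structure IsC0Semigroup {X : Type*} [NormedAddCommGroup X] [NormedSpace ℝ X]
    (S : ℝ≥0 → X →L[ℝ] X) : Prop where
  map_zero : S 0 = ContinuousLinearMap.id ℝ X
  map_add : ∀ s t, S (s + t) = (S s).comp (S t)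
  continuous : ∀ x, Continuous fun t => S t x

/-- `(x, y)` is in the graph of the infinitesimal generator of `S`:
`(S t x - x) / t → y` as `t ↓ 0`. -/
def InGeneratorGraph {X : Type*} [NormedAddCommGroup X] [NormedSpace ℝ X]
    (S : ℝ≥0 → X →L[ℝ] X) (x y : X) : Prop :=
  Tendsto (fun t : ℝ≥0 => (t : ℝ)⁻¹ • (S t x - x)) (𝓝[>] 0) (𝓝 y)

/-- `S t = e^{tA}`: `S` is a strongly continuous semigroup on `L²(O)` and its generator is exactly
the operator `A` (same domain, same values). -/
def IsSemigroupOf {d : ℕ} {O : Set (EuclideanSpace ℝ (Fin d))}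
    (a : EuclideanSpace ℝ (Fin d) → Matrix (Fin d) (Fin d) ℝ) (S : ℝ≥0 → L2 O →L[ℝ] L2 O) : Prop :=
  IsC0Semigroup S ∧ ∀ u f : L2 O, InGeneratorGraph S u f ↔ IsConormalRealization a u f

/-- The invariant measure `μ = |O|⁻¹ λ_d` on `O` of the divergence type operator. -/
noncomputable def invMeasure {d : ℕ} (O : Set (EuclideanSpace ℝ (Fin d))) :
    Measure (EuclideanSpace ℝ (Fin d)) :=
  (volume O)⁻¹ • volume.restrict O

/-- The spatial average `⟨x, μ⟩ = ∫_O x dμ`. -/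
noncomputable def average {d : ℕ} {O : Set (EuclideanSpace ℝ (Fin d))} (x : L2 O) : ℝ :=
  ∫ ξ, x ξ ∂(invMeasure O)

/-- `g` has quadratic growth at infinity: it lies between two positive multiples of `s ^ 2` for all
large `|s|`. -/
def HasQuadraticGrowth (g : ℝ → ℝ) : Prop :=
  ∃ c C R : ℝ, 0 < c ∧ ∀ s : ℝ, R ≤ |s| → c * s ^ 2 ≤ g s ∧ g s ≤ C * s ^ 2

/-- The sublevel set `𝒟_g(r) = {x ∈ H | ∫_O g(x(ξ)) dξ < r}`. -/
def sublevelDomain {d : ℕ} (O : Set (EuclideanSpace ℝ (Fin d))) (g : ℝ → ℝ) (r : ℝ) :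
    Set (L2 O) :=
  {x | ∫ ξ in O, g (x ξ) < r}

/-- The condition on a domain `D` of the exit problem: `D` is open, bounded and connected,
contains `0`, is invariant under the semigroup `S t = e^{tA}`, and contains the constant function
`⟨x, μ⟩` for each `x ∈ D`. (`L²(O, μ)` is `L²(O)` with the norm multiplied by `|O|^{-1/2}`, so that
the topological notions below are the same in both spaces.) -/
structure IsExitDomain {d : ℕ} {O : Set (EuclideanSpace ℝ (Fin d))}
    (S : ℝ≥0 → L2 O →L[ℝ] L2 O) (D : Set (L2 O)) : Prop where
  isOpen : IsOpen D
  isBounded : Bornology.IsBounded D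
  isConnected : IsConnected D
  zero_mem : (0 : L2 O) ∈ D
  semigroup_invariant : ∀ t : ℝ≥0, ∀ x ∈ D, S t x ∈ D
  average_mem : ∀ x ∈ D, ∃ y ∈ D, y =ᵐ[volume.restrict O] fun _ => average x

end NeumannExit

/-! `A` is the operator of the Dirichlet form `∫ ⟨a ∇u, ∇v⟩` on the Hilbert space `H¹(O)`. By
Lax–Milgram it is densely defined and maximal dissipative, so it generates a contraction semigroup
(Hille–Yosida), and dissipativity makes the semigroup unique.

The semigroup is the strong limit of the exponentials of the Yosida approximations `ε⁻¹ (J - 1)`,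
with `J = (1 - ε A)⁻¹`. Since `exp (s (J - 1)) = e^{-s} ∑ sⁿ/n! Jⁿ` is a Poisson average of powers
of `J`, every closed convex set invariant under all resolvents is invariant under the semigroup.

Invariance thus reduces to `G u ≤ G (u - ε A u)` on the domain of `A`. By convexity `g (u - ε A u) ≥
g u - ε g'(u) A u`, so it suffices that `∫ g'(u) A u ≤ 0`. Formally this integral is `-∫ g''(u) ⟨a
∇u, ∇u⟩`. As `g''` may be unbounded, `g'(u)` need not lie in `H¹(O)`: the identity is used for `g' ∘
θₙ`, with `θₙ` bounded increasing truncations, where a chain rule proved by mollification applies,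
and dominated convergence removes the truncation.

The other properties come from `G` alone. It is finite and convex, and bounded above near `0`, hence
continuous, so the sublevel sets are convex and open. The lower quadratic bound on `g` makes them
bounded, and Jensen's inequality gives the statement on averages. -/

namespace NeumannExit

/-! ### Exponentials of `s (J - 1)` as averages of powers -/

section ExpContraction

open NormedSpace

variable {X : Type*} [NormedAddCommGroup X] [NormedSpace ℝ X] [CompleteSpace X]

/-- The scalar part `-s` commutes with `s • J`, so its exponential splits off. The factor `e^{-s}`
normalizes the weights `sⁿ/n!` to total mass one. -/
theorem exp_smul_sub_one (J : X →L[ℝ] X) (s : ℝ) :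
    exp (s • (J - 1)) = Real.exp (-s) • exp (s • J) := by
  have h1 : s • (J - 1) = algebraMap ℝ (X →L[ℝ] X) (-s) + s • J := by
    rw [Algebra.algebraMap_eq_smul_one]; module
  let _ : NormedAlgebra ℚ (X →L[ℝ] X) := .restrictScalars ℚ ℝ _
  rw [h1, exp_add_of_commute (Algebra.commutes _ _), ← algebraMap_exp_comm,
    ← Real.exp_eq_exp_ℝ, ← Algebra.smul_def]

theorem hasSum_exp_smul_apply (J : X →L[ℝ] X) (s : ℝ) (x : X) :
    HasSum (fun n : ℕ => (s ^ n / n.factorial) • (J ^ n) x) (exp (s • J) x) := by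
  have := (exp_series_hasSum_exp' (𝕂 := ℝ) (s • J)).mapL (ContinuousLinearMap.apply ℝ X x)
  simpa [smul_pow, smul_smul, div_eq_inv_mul] using this

/-- The exponential of `s (J - 1)` maps a closed convex set invariant under `J` to itself. -/
theorem exp_smul_sub_one_mem {C : Set X} (hC : Convex ℝ C) (hC' : IsClosed C) {J : X →L[ℝ] X}
    (hJ : ∀ x ∈ C, J x ∈ C) {s : ℝ} (hs : 0 ≤ s) {x : X} (hx : x ∈ C) :
    exp (s • (J - 1)) x ∈ C := by
  have hpow : ∀ n : ℕ, (J ^ n) x ∈ C := by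
    intro n
    induction n with
    | zero => simpa
    | succ n ih => rw [pow_succ']; exact hJ _ ih
  have h1 : HasSum (fun n : ℕ => s ^ n / n.factorial) (Real.exp s) := by
    have := exp_series_hasSum_exp' (𝕂 := ℝ) s
    rw [← Real.exp_eq_exp_ℝ] at this
    simpa [div_eq_inv_mul] using this
  -- Partial sums of the exponential series, divided by the partial sums of their own weights, are
  -- genuine convex combinations of the points `Jⁿ x`.
  have h2 := (h1.tendsto_sum_nat.inv₀ (Real.exp_pos s).ne').smul
    (hasSum_exp_smul_apply J s x).tendsto_sum_nat
  rw [exp_smul_sub_one, Real.exp_neg]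
  refine hC'.mem_of_tendsto h2 ?_
  -- For `n = 0` the sum is empty and its total weight is zero, so it cannot be normalized.
  filter_upwards [eventually_ge_atTop 1] with n hn
  refine hC.centerMass_mem (fun i _ => by positivity) ?_ fun i _ => hpow i
  refine Finset.sum_pos' (fun i _ => by positivity) ⟨0, Finset.mem_range.2 hn, by simp⟩

theorem norm_exp_smul_sub_one_apply_le {J : X →L[ℝ] X} (hJ : ∀ x, ‖J x‖ ≤ ‖x‖) {s : ℝ}
    (hs : 0 ≤ s) (x : X) : ‖exp (s • (J - 1)) x‖ ≤ ‖x‖ := by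
  have := exp_smul_sub_one_mem (convex_closedBall 0 ‖x‖) Metric.isClosed_closedBall
    (J := J) (fun y hy => by
      rw [mem_closedBall_zero_iff] at *
      exact (hJ y).trans hy) hs (x := x) (by simp)
  simpa using this

end ExpContraction

/-- Convergence to zero on a dense set extends by equicontinuity. -/
theorem tendsto_zero_of_dense {X ι : Type*} [SeminormedAddCommGroup X] {l : Filter ι}
    {D : Set X} (hD : Dense D) (c : ℝ) {F : ι → X → ℝ} (hF : ∀ i x, 0 ≤ F i x)
    (hF' : ∀ i x z, F i x ≤ F i z + c * ‖x - z‖)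
    (h : ∀ z ∈ D, Tendsto (fun i => F i z) l (𝓝 0)) (x : X) :
    Tendsto (fun i => F i x) l (𝓝 0) := by
  rw [Metric.tendsto_nhds]
  intro η hη
  obtain ⟨z, hxz, hz⟩ := Metric.dense_iff.1 hD x (η / (2 * (|c| + 1))) (by positivity)
  filter_upwards [(h z hz).eventually (gt_mem_nhds (half_pos hη))] with i hi
  rw [Real.dist_eq, sub_zero, abs_of_nonneg (hF i x)]
  have h1 : ‖x - z‖ < η / (2 * (|c| + 1)) := by
    rw [← dist_eq_norm, dist_comm]; exact hxz
  rw [lt_div_iff₀ (by positivity)] at h1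
  nlinarith [hF' i x z, norm_nonneg (x - z), le_abs_self c]

/-! ### Maximal dissipative relations and their resolvents -/

section Resolvent

open scoped InnerProductSpace

variable {X : Type*} [NormedAddCommGroup X] [InnerProductSpace ℝ X]

/-- The linear relation `Γ` is the graph of a densely defined maximal dissipative operator. -/
structure IsMaximalDissipative (Γ : Submodule ℝ (X × X)) : Prop where
  inner_nonpos : ∀ p ∈ Γ, ⟪p.2, p.1⟫_ℝ ≤ 0
  exists_sub_smul_eq : ∀ ε : ℝ, 0 < ε → ∀ f : X, ∃ p ∈ Γ, p.1 - ε • p.2 = f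
  dense_domain : Dense {x : X | ∃ y, (x, y) ∈ Γ}

/-- `J = (1 - ε A)⁻¹`, where `Γ` is the graph of `A`. -/
structure IsResolvent (Γ : Submodule ℝ (X × X)) (ε : ℝ) (J : X →L[ℝ] X) : Prop where
  norm_le : ∀ x, ‖J x‖ ≤ ‖x‖
  mem : ∀ f, (J f, ε⁻¹ • (J f - f)) ∈ Γ
  apply_sub : ∀ p ∈ Γ, J (p.1 - ε • p.2) = p.1

variable {Γ : Submodule ℝ (X × X)}

/-- Pairing `p.1 - ε • p.2` with `p.1` and using Cauchy–Schwarz. This yields both the injectivity of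
`1 - ε A` and the contractivity of its inverse. -/
theorem norm_fst_le_of_inner_nonpos {p : X × X} (hp : ⟪p.2, p.1⟫_ℝ ≤ 0) {ε : ℝ} (hε : 0 ≤ ε) :
    ‖p.1‖ ≤ ‖p.1 - ε • p.2‖ := by
  rcases (norm_nonneg p.1).eq_or_lt with h | h
  · rw [← h]; positivity
  · have h1 : ‖p.1‖ * ‖p.1‖ ≤ ⟪p.1 - ε • p.2, p.1⟫_ℝ := by
      rw [inner_sub_left, real_inner_smul_left, real_inner_self_eq_norm_mul_norm]
      nlinarith
    exact le_of_mul_le_mul_right (h1.trans (real_inner_le_norm _ _)) h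

theorem IsMaximalDissipative.exists_isResolvent (hΓ : IsMaximalDissipative Γ) {ε : ℝ}
    (hε : 0 < ε) : ∃ J : X →L[ℝ] X, IsResolvent Γ ε J := by
  choose P hP hPf using hΓ.exists_sub_smul_eq ε hε
  have huniq : ∀ p ∈ Γ, ∀ q ∈ Γ, p.1 - ε • p.2 = q.1 - ε • q.2 → p.1 = q.1 := by
    intro p hp q hq h
    have := norm_fst_le_of_inner_nonpos (hΓ.inner_nonpos _ (Γ.sub_mem hp hq)) hε.le
    have h0 : (p - q).1 - ε • (p - q).2 = 0 := by
      simp only [Prod.fst_sub, Prod.snd_sub, smul_sub]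
      rw [sub_sub_sub_comm, h, sub_self]
    rw [h0, norm_zero] at this
    exact sub_eq_zero.1 (norm_le_zero_iff.1 this)
  let J₀ : X →ₗ[ℝ] X :=
    { toFun := fun f => (P f).1
      map_add' := fun f g => by
        refine huniq _ (hP _) _ (Γ.add_mem (hP f) (hP g)) ?_
        rw [hPf, Prod.fst_add, Prod.snd_add, smul_add, add_sub_add_comm, hPf, hPf]
      map_smul' := fun c f => by
        refine huniq _ (hP _) _ (Γ.smul_mem c (hP f)) ?_
        rw [hPf, Prod.smul_fst, Prod.smul_snd, smul_comm, ← smul_sub, hPf] }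
  have hnorm : ∀ f, ‖J₀ f‖ ≤ 1 * ‖f‖ := fun f => by
    have := norm_fst_le_of_inner_nonpos (hΓ.inner_nonpos _ (hP f)) hε.le
    rw [hPf] at this
    rwa [one_mul]
  refine ⟨J₀.mkContinuous 1 hnorm, fun x => by simpa using hnorm x, fun f => ?_, fun p hp => ?_⟩
  · have : ε⁻¹ • ((P f).1 - f) = (P f).2 := by
      rw [inv_smul_eq_iff₀ hε.ne']
      nth_rw 2 [← hPf f]
      abel
    change ((P f).1, ε⁻¹ • ((P f).1 - f)) ∈ Γ
    rw [this]; exact hP f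
  · exact huniq _ (hP _) _ hp (hPf _)

variable {ε δ : ℝ} {J K : X →L[ℝ] X}

theorem IsResolvent.sub_eq (hJ : IsResolvent Γ ε J) {x y : X} (h : (x, y) ∈ Γ) :
    J x - x = ε • J y := by
  have := hJ.apply_sub _ h
  simp only [map_sub, map_smul] at this
  rw [sub_eq_iff_eq_add] at this ⊢
  rw [this]; abel

/-- Each resolvent maps the graph of `A` to itself, so applying `J` to the equation solved by `K f`
gives the equation solved by `K (J f)`. -/
theorem IsResolvent.commute (hJ : IsResolvent Γ ε J) (hε : 0 < ε) (hK : IsResolvent Γ δ K)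
    (hδ : 0 < δ) : Commute J K := by
  have hmap : ∀ x y, (x, y) ∈ Γ → (J x, J y) ∈ Γ := fun x y h => by
    have := hJ.mem x
    rwa [hJ.sub_eq h, inv_smul_smul₀ hε.ne'] at this
  ext f
  have h := hK.apply_sub _ (hmap _ _ (hK.mem f))
  simp only [map_smul, smul_inv_smul₀ hδ.ne', map_sub, sub_sub_cancel] at h
  exact h.symm

/-- On the domain of `A` the Yosida approximation is `J A`, which is bounded by `A` and converges to
it as `ε → 0`. -/
theorem IsResolvent.inv_smul_sub (hJ : IsResolvent Γ ε J) (hε : 0 < ε) {x y : X}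
    (h : (x, y) ∈ Γ) : (ε⁻¹ • (J - 1)) x = J y := by
  change ε⁻¹ • (J x - x) = J y
  rw [hJ.sub_eq h, inv_smul_smul₀ hε.ne']

/-- The resolvents converge strongly to the identity. -/
theorem tendsto_resolvent (hΓ : IsMaximalDissipative Γ) {ε : ℕ → ℝ} (hε : Tendsto ε atTop (𝓝 0))
    {J : ℕ → X →L[ℝ] X} (hJ : ∀ n, IsResolvent Γ (ε n) (J n)) (x : X) :
    Tendsto (fun n => J n x) atTop (𝓝 x) := by
  rw [tendsto_iff_norm_sub_tendsto_zero]
  refine tendsto_zero_of_dense hΓ.dense_domain 2 (F := fun n x => ‖J n x - x‖)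
    (fun n x => norm_nonneg _) (fun n x z => ?_) ?_ x
  · have : J n x - x = (J n z - z) + J n (x - z) - (x - z) := by rw [map_sub]; abel
    calc ‖J n x - x‖ ≤ ‖J n z - z‖ + ‖J n (x - z)‖ + ‖x - z‖ := by
          rw [this]; exact (norm_sub_le _ _).trans (by gcongr; exact norm_add_le _ _)
      _ ≤ _ := by linarith [(hJ n).norm_le (x - z)]
  · rintro z ⟨y, hz⟩
    have h1 : Tendsto (fun n => |ε n| * ‖y‖) atTop (𝓝 0) := by
      simpa using hε.abs.mul_const ‖y‖
    refine squeeze_zero (fun n => norm_nonneg _) (fun n => ?_) h1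
    rw [(hJ n).sub_eq hz, norm_smul, Real.norm_eq_abs]
    gcongr
    exact (hJ n).norm_le y

end Resolvent

/-! ### Estimates for the Yosida approximations -/

section Yosida

open NormedSpace

variable {X : Type*} [NormedAddCommGroup X] [InnerProductSpace ℝ X] [CompleteSpace X]

/-- The Yosida approximation `exp (t A J)`, `A J = ε⁻¹ (J - 1)`, of `e^{tA}`. -/
noncomputable def yosida (ε : ℝ) (J : X →L[ℝ] X) (t : ℝ) : X →L[ℝ] X :=
  exp (t • (ε⁻¹ • (J - 1)))

variable {Γ : Submodule ℝ (X × X)} {ε δ : ℝ} {J K : X →L[ℝ] X}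

theorem yosida_mem {C : Set X} (hC : Convex ℝ C) (hC' : IsClosed C) (hJ : ∀ x ∈ C, J x ∈ C)
    (hε : 0 < ε) {t : ℝ} (ht : 0 ≤ t) {x : X} (hx : x ∈ C) : yosida ε J t x ∈ C := by
  rw [yosida, smul_smul]
  exact exp_smul_sub_one_mem hC hC' hJ (by positivity) hx

theorem norm_yosida_apply_le (hJ : ∀ x, ‖J x‖ ≤ ‖x‖) (hε : 0 < ε) {t : ℝ} (ht : 0 ≤ t) (x : X) :
    ‖yosida ε J t x‖ ≤ ‖x‖ := by
  rw [yosida, smul_smul]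
  exact norm_exp_smul_sub_one_apply_le hJ (by positivity) x

omit [CompleteSpace X] in
theorem yosida_zero : yosida ε J 0 = 1 := by simp [yosida]

theorem yosida_add (s t : ℝ) : yosida ε J (s + t) = yosida ε J s * yosida ε J t := by
  let _ : NormedAlgebra ℚ (X →L[ℝ] X) := .restrictScalars ℚ ℝ _
  rw [yosida, add_smul, exp_add_of_commute]
  · rfl
  · exact ((Commute.refl _).smul_left _).smul_right _

theorem hasDerivAt_yosida (t : ℝ) :
    HasDerivAt (yosida ε J) (yosida ε J t * (ε⁻¹ • (J - 1))) t :=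
  hasDerivAt_exp_smul_const (𝕂 := ℝ) (𝔸 := X →L[ℝ] X) (ε⁻¹ • (J - 1)) t

theorem norm_yosida_sub_le (hJ : ∀ x, ‖J x‖ ≤ ‖x‖) (hε : 0 < ε) {s t : ℝ} (hs : 0 ≤ s)
    (ht : 0 ≤ t) (x : X) :
    ‖yosida ε J t x - yosida ε J s x‖ ≤ ‖(ε⁻¹ • (J - 1)) x‖ * |t - s| := by
  refine (convex_Ici (0 : ℝ)).norm_image_sub_le_of_norm_hasDerivWithin_le
    (f := fun t => yosida ε J t x) (f' := fun t => (yosida ε J t * (ε⁻¹ • (J - 1))) x)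
    (fun r _ => ?_) (fun r hr => ?_) hs ht
  · exact ((hasDerivAt_yosida r).clm_apply (hasDerivAt_const r x)).hasDerivWithinAt.congr_deriv
      (by simp)
  · exact norm_yosida_apply_le hJ hε hr _

/-- The path `r ↦ e^{rA} e^{(t-r)B} x` joins the two terms. Because `A` and `B` commute, its
derivative is a product of contractions applied to `A x - B x`. -/
theorem norm_yosida_sub_yosida_le (hJ : ∀ x, ‖J x‖ ≤ ‖x‖) (hε : 0 < ε) (hK : ∀ x, ‖K x‖ ≤ ‖x‖)
    (hδ : 0 < δ) (hJK : Commute J K) {t : ℝ} (ht : 0 ≤ t) (x : X) :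
    ‖yosida ε J t x - yosida δ K t x‖ ≤
      ‖(ε⁻¹ • (J - 1)) x - (δ⁻¹ • (K - 1)) x‖ * t := by
  set A := ε⁻¹ • (J - 1) with hA
  set B := δ⁻¹ • (K - 1)
  have hAB : Commute A B :=
    (((hJK.sub_left (Commute.one_left _)).sub_right (Commute.one_right _)).smul_left _).smul_right _
  have hAY : ∀ r, Commute A (yosida δ K r) := fun r => by
    let _ : NormedAlgebra ℚ (X →L[ℝ] X) := .restrictScalars ℚ ℝ _
    exact (hAB.smul_right r).exp_right
  have hder : ∀ r, HasDerivAt (fun r => yosida ε J r (yosida δ K (t - r) x))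
      (yosida ε J r (yosida δ K (t - r) (A x - B x))) r := fun r => by
    have h1 := (hasDerivAt_yosida (ε := δ) (J := K) (t - r)).clm_apply
      (hasDerivAt_const (t - r) x)
    have h2 : HasDerivAt (fun r => yosida δ K (t - r) x) _ r := h1.comp_const_sub t r
    have h3 := (hasDerivAt_yosida (ε := ε) (J := J) r).clm_apply h2
    refine h3.congr_deriv ?_
    have h4 : A (yosida δ K (t - r) x) = yosida δ K (t - r) (A x) :=
      congrArg (fun T : X →L[ℝ] X => T x) (hAY (t - r)).eq
    change yosida ε J r (A (yosida δ K (t - r) x)) +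
      yosida ε J r (-(yosida δ K (t - r) (B x) + yosida δ K (t - r) 0)) = _
    rw [h4, map_zero, add_zero, ← map_add, ← sub_eq_add_neg, ← map_sub]
  have := norm_image_sub_le_of_norm_deriv_le_segment' (a := 0) (b := t)
    (f := fun r => yosida ε J r (yosida δ K (t - r) x))
    (C := ‖A x - B x‖) (fun r _ => (hder r).hasDerivWithinAt) (fun r hr => ?_) t ⟨ht, le_rfl⟩
  · simpa [yosida_zero] using this
  · exact (norm_yosida_apply_le hJ hε hr.1 _).trans
      (norm_yosida_apply_le hK hδ (sub_nonneg.2 hr.2.le) _)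

/-- A first-order expansion at `t = 0` that survives the limit `ε → 0`. As `p.2` need not be in the
domain, a domain element `q.1` near it is inserted, and the motion of `q.1` costs at most `t *
‖q.2‖`. -/
theorem norm_yosida_sub_sub_smul_le (hJ : IsResolvent Γ ε J) (hε : 0 < ε) {p q : X × X}
    (hp : p ∈ Γ) (hq : q ∈ Γ) {t : ℝ} (ht : 0 ≤ t) :
    ‖yosida ε J t p.1 - p.1 - t • p.2‖ ≤
      (‖J p.2 - p.2‖ + 2 * ‖p.2 - q.1‖ + t * ‖q.2‖) * t := by
  have hder : ∀ r, HasDerivAt (fun r => yosida ε J r p.1 - r • p.2)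
      (yosida ε J r (J p.2) - p.2) r := fun r => by
    have h1 := (hasDerivAt_yosida (ε := ε) (J := J) r).clm_apply (hasDerivAt_const r p.1)
    have h2 := (hasDerivAt_id r).smul_const p.2
    refine (h1.sub h2).congr_deriv ?_
    have := hJ.inv_smul_sub hε hp
    rw [mul_apply_eq_comp, this]
    simp
  have := norm_image_sub_le_of_norm_deriv_le_segment' (a := 0) (b := t)
    (f := fun r => yosida ε J r p.1 - r • p.2)
    (C := ‖J p.2 - p.2‖ + 2 * ‖p.2 - q.1‖ + t * ‖q.2‖)
    (fun r _ => (hder r).hasDerivWithinAt) (fun r hr => ?_) t ⟨ht, le_rfl⟩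
  · simpa [yosida_zero, sub_right_comm] using this
  · have h1 := norm_yosida_apply_le hJ.norm_le hε hr.1 (J p.2 - p.2)
    have h2 := norm_yosida_apply_le hJ.norm_le hε hr.1 (p.2 - q.1)
    have h3 := norm_yosida_sub_le hJ.norm_le hε le_rfl hr.1 q.1
    rw [hJ.inv_smul_sub hε hq, yosida_zero, sub_zero, abs_of_nonneg hr.1] at h3
    have h4 : ‖J q.2‖ * r ≤ t * ‖q.2‖ := by
      rw [mul_comm]
      exact mul_le_mul hr.2.le (hJ.norm_le _) (norm_nonneg _) ht
    have h5 : yosida ε J r (J p.2) - p.2 = yosida ε J r (J p.2 - p.2) +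
        yosida ε J r (p.2 - q.1) + (yosida ε J r q.1 - (1 : X →L[ℝ] X) q.1) - (p.2 - q.1) := by
      simp only [map_sub, one_apply_eq_self]; abel
    rw [h5]
    refine (norm_sub_le _ _).trans ?_
    have h6 := norm_add₃_le (a := yosida ε J r (J p.2 - p.2)) (b := yosida ε J r (p.2 - q.1))
      (c := yosida ε J r q.1 - (1 : X →L[ℝ] X) q.1)
    linarith

end Yosida

/-! ### Hille–Yosida generation and invariant convex sets -/

section Generation

open scoped InnerProductSpace

variable {X : Type*} [NormedAddCommGroup X] [InnerProductSpace ℝ X] [CompleteSpace X]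
variable {Γ : Submodule ℝ (X × X)}

omit [CompleteSpace X] in
theorem exists_isResolvent_seq (hΓ : IsMaximalDissipative Γ) :
    ∃ (ε : ℕ → ℝ) (J : ℕ → X →L[ℝ] X), (∀ n, 0 < ε n) ∧ Tendsto ε atTop (𝓝 0) ∧
      ∀ n, IsResolvent Γ (ε n) (J n) := by
  have h : ∀ n : ℕ, 0 < 1 / ((n : ℝ) + 1) := fun n => by positivity
  choose J hJ using fun n => hΓ.exists_isResolvent (h n)
  exact ⟨_, J, h, tendsto_one_div_add_atTop_nhds_zero_nat, hJ⟩

section Limit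

variable {ε : ℕ → ℝ} {J : ℕ → X →L[ℝ] X}

/-- On the domain, the difference of two approximations is at most `t ‖Jₙ y - Jₘ y‖`, which is
Cauchy because `Jₙ y → y`. Contractivity extends this to all of `X`. -/
theorem exists_tendsto_yosida (hΓ : IsMaximalDissipative Γ) (hε : ∀ n, 0 < ε n)
    (hε' : Tendsto ε atTop (𝓝 0)) (hJ : ∀ n, IsResolvent Γ (ε n) (J n)) {t : ℝ} (ht : 0 ≤ t)
    (x : X) : ∃ y, Tendsto (fun n => yosida (ε n) (J n) t x) atTop (𝓝 y) := by
  apply cauchySeq_tendsto_of_complete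
  rw [cauchySeq_iff_tendsto_dist_atTop_0]
  simp_rw [dist_eq_norm]
  refine tendsto_zero_of_dense hΓ.dense_domain 2
    (F := fun n : ℕ × ℕ => fun x => ‖yosida (ε n.1) (J n.1) t x - yosida (ε n.2) (J n.2) t x‖)
    (fun n x => norm_nonneg _) (fun n x z => ?_) ?_ x
  · have h1 := norm_yosida_apply_le (hJ n.1).norm_le (hε n.1) ht (x - z)
    have h2 := norm_yosida_apply_le (hJ n.2).norm_le (hε n.2) ht (x - z)
    rw [map_sub] at h1 h2
    calc _ = ‖(yosida (ε n.1) (J n.1) t z - yosida (ε n.2) (J n.2) t z)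
          + (yosida (ε n.1) (J n.1) t x - yosida (ε n.1) (J n.1) t z)
          - (yosida (ε n.2) (J n.2) t x - yosida (ε n.2) (J n.2) t z)‖ := by congr 1; abel
      _ ≤ _ := by
        refine (norm_sub_le _ _).trans ((add_le_add_left (norm_add_le _ _) _).trans ?_)
        linarith
  · rintro z ⟨y, hz⟩
    have h1 := (cauchySeq_iff_tendsto_dist_atTop_0.1
      (tendsto_resolvent hΓ hε' hJ y).cauchySeq).mul_const t
    rw [zero_mul] at h1
    refine squeeze_zero (fun n => norm_nonneg _) (fun n => ?_) h1
    have h2 := norm_yosida_sub_yosida_le (hJ n.1).norm_le (hε n.1) (hJ n.2).norm_le (hε n.2)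
      ((hJ n.1).commute (hε _) (hJ n.2) (hε _)) ht z
    rwa [(hJ n.1).inv_smul_sub (hε _) hz, (hJ n.2).inv_smul_sub (hε _) hz,
      ← dist_eq_norm (J n.1 y)] at h2

end Limit

/-- The contraction semigroup generated by a maximal dissipative operator. -/
theorem exists_semigroup_of_isMaximalDissipative (hΓ : IsMaximalDissipative Γ) :
    ∃ S : ℝ≥0 → X →L[ℝ] X, IsC0Semigroup S ∧ (∀ t x, ‖S t x‖ ≤ ‖x‖) ∧
      (∀ p ∈ Γ, InGeneratorGraph S p.1 p.2) ∧
      ∀ C : Set X, Convex ℝ C → IsClosed C →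
        (∀ p ∈ Γ, ∀ ε : ℝ, 0 < ε → p.1 - ε • p.2 ∈ C → p.1 ∈ C) → ∀ t, ∀ x ∈ C, S t x ∈ C := by
  obtain ⟨ε, J, hε, hε', hJ⟩ := exists_isResolvent_seq hΓ
  choose L hL using fun t : ℝ≥0 => exists_tendsto_yosida hΓ hε hε' hJ t.2
  have hY : ∀ n (t : ℝ≥0) x, ‖yosida (ε n) (J n) t x‖ ≤ ‖x‖ := fun n t x =>
    norm_yosida_apply_le (hJ n).norm_le (hε n) t.2 x
  have hLle : ∀ t x, ‖L t x‖ ≤ ‖x‖ := fun t x =>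
    le_of_tendsto' (hL t x).norm fun n => hY n t x
  let S : ℝ≥0 → X →L[ℝ] X := fun t => LinearMap.mkContinuous
    { toFun := L t
      map_add' := fun x y => tendsto_nhds_unique (hL t (x + y)) <| by
        simpa only [map_add] using (hL t x).add (hL t y)
      map_smul' := fun c x => tendsto_nhds_unique (hL t (c • x)) <| by
        simpa only [map_smul, RingHom.id_apply] using (hL t x).const_smul c } 1
    fun x => by simpa using hLle t x
  have hS : ∀ (t : ℝ≥0) x, Tendsto (fun n => yosida (ε n) (J n) t x) atTop (𝓝 (S t x)) := hL
  have hSle : ∀ t x, ‖S t x‖ ≤ ‖x‖ := hLle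
  have hlip : ∀ p ∈ Γ, ∀ n (s t : ℝ≥0), ‖yosida (ε n) (J n) t p.1 - yosida (ε n) (J n) s p.1‖ ≤
      ‖p.2‖ * |(t : ℝ) - s| := fun p hp n s t => by
    refine (norm_yosida_sub_le (hJ n).norm_le (hε n) s.2 t.2 p.1).trans ?_
    rw [(hJ n).inv_smul_sub (hε n) hp]
    exact mul_le_mul_of_nonneg_right ((hJ n).norm_le _) (abs_nonneg _)
  have hSlip : ∀ p ∈ Γ, ∀ (s t : ℝ≥0), ‖S t p.1 - S s p.1‖ ≤ ‖p.2‖ * |(t : ℝ) - s| :=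
    fun p hp s t => le_of_tendsto' ((hS t p.1).sub (hS s p.1)).norm fun n => hlip p hp n s t
  refine ⟨S, ⟨?_, ?_, ?_⟩, hSle, ?_, ?_⟩
  · ext x
    refine tendsto_nhds_unique (hS 0 x) ?_
    simp [yosida_zero]
  · intro s t
    ext x
    refine tendsto_nhds_unique (hS (s + t) x) ?_
    -- The contraction bound, uniform in `n`, allows the inner limit to be taken before the outer
    -- one.
    have h1 : Tendsto (fun n => yosida (ε n) (J n) s (yosida (ε n) (J n) t x - S t x)) atTop
        (𝓝 0) := by
      refine squeeze_zero_norm (fun n => hY n s _) ?_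
      simpa using ((hS t x).sub_const (S t x)).norm
    have h2 := h1.add (hS s (S t x))
    rw [zero_add] at h2
    refine h2.congr fun n => ?_
    rw [map_sub, sub_add_cancel, NNReal.coe_add, yosida_add]
    rfl
  · intro x
    rw [continuous_iff_continuousAt]
    intro s
    rw [ContinuousAt, tendsto_iff_norm_sub_tendsto_zero]
    refine tendsto_zero_of_dense hΓ.dense_domain 2 (F := fun t x => ‖S t x - S s x‖)
      (fun n x => norm_nonneg _) (fun t x z => ?_) ?_ x
    · have h1 := hSle t (x - z)
      have h2 := hSle s (x - z)
      rw [map_sub] at h1 h2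
      calc ‖S t x - S s x‖ = ‖(S t z - S s z) + (S t x - S t z) - (S s x - S s z)‖ := by
            congr 1; abel
        _ ≤ ‖S t z - S s z‖ + ‖S t x - S t z‖ + ‖S s x - S s z‖ :=
            (norm_sub_le _ _).trans (by gcongr; exact norm_add_le _ _)
        _ ≤ _ := by linarith
    · rintro z ⟨y, hz⟩
      refine squeeze_zero (fun n => norm_nonneg _) (fun t => hSlip _ hz s t) ?_
      have : Continuous fun t : ℝ≥0 => ‖y‖ * |(t : ℝ) - s| := by fun_prop
      simpa using this.tendsto s
  · intro p hp
    rw [InGeneratorGraph, Metric.tendsto_nhds]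
    intro η hη
    obtain ⟨z, hz, w, hzw⟩ := Metric.dense_iff.1 hΓ.dense_domain p.2 (η / 4) (by positivity)
    have hz' : ‖p.2 - z‖ < η / 4 := by rw [← dist_eq_norm, dist_comm]; exact hz
    have hest : ∀ t : ℝ≥0, ‖S t p.1 - p.1 - (t : ℝ) • p.2‖ ≤
        (0 + 2 * ‖p.2 - z‖ + t * ‖w‖) * t := fun t => by
      have h1 : Tendsto (fun n => ‖J n p.2 - p.2‖) atTop (𝓝 0) := by
        rw [← tendsto_iff_norm_sub_tendsto_zero]
        exact tendsto_resolvent hΓ hε' hJ p.2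
      exact le_of_tendsto_of_tendsto' (((hS t p.1).sub_const _).sub_const _).norm
        (((h1.add_const _).add_const _).mul_const _) fun n =>
          norm_yosida_sub_sub_smul_le (hJ n) (hε n) hp hzw t.2
    have h2 : Tendsto (fun t : ℝ≥0 => (t : ℝ) * ‖w‖) (𝓝[>] 0) (𝓝 0) := by
      have : Continuous fun t : ℝ≥0 => (t : ℝ) * ‖w‖ := by fun_prop
      simpa using (this.tendsto 0).mono_left nhdsWithin_le_nhds
    filter_upwards [h2.eventually (gt_mem_nhds (half_pos hη)), self_mem_nhdsWithin] with t ht ht0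
    have ht0' : (0 : ℝ) < t := ht0
    rw [dist_eq_norm, ← mul_lt_mul_iff_of_pos_left ht0']
    calc (t : ℝ) * ‖(t : ℝ)⁻¹ • (S t p.1 - p.1) - p.2‖
        = ‖S t p.1 - p.1 - (t : ℝ) • p.2‖ := by
          rw [← Real.norm_of_nonneg ht0'.le, ← norm_smul, smul_sub, Real.norm_of_nonneg ht0'.le,
            smul_inv_smul₀ ht0'.ne']
      _ ≤ (0 + 2 * ‖p.2 - z‖ + t * ‖w‖) * t := hest t
      _ < t * η := by rw [mul_comm]; gcongr; linarith
  -- Invariance passes from the resolvents to the exponentials by convexity, and then to the strong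
  -- limit by closedness.
  · intro C hC hC' hinv t x hx
    refine hC'.mem_of_tendsto (hS t x) (Eventually.of_forall fun n => ?_)
    refine yosida_mem hC hC' (fun y hy => ?_) (hε n) t.2 hx
    refine hinv _ ((hJ n).mem y) (ε n) (hε n) ?_
    simpa [smul_inv_smul₀ (hε n).ne'] using hy

end Generation

/-! ### Identification of the generator and uniqueness -/

section Generator

open scoped InnerProductSpace

variable {X : Type*} [NormedAddCommGroup X] [InnerProductSpace ℝ X]
variable {S T : ℝ≥0 → X →L[ℝ] X}

theorem InGeneratorGraph.sub {x y x' y' : X} (h : InGeneratorGraph S x y)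
    (h' : InGeneratorGraph S x' y') : InGeneratorGraph S (x - x') (y - y') := by
  refine (Tendsto.sub h h').congr fun t => ?_
  rw [← smul_sub, map_sub, sub_sub_sub_comm]

theorem InGeneratorGraph.inner_nonpos (hS : ∀ t x, ‖S t x‖ ≤ ‖x‖) {x y : X}
    (h : InGeneratorGraph S x y) : ⟪y, x⟫_ℝ ≤ 0 := by
  refine le_of_tendsto (Tendsto.inner h (tendsto_const_nhds (x := x)))
    (Eventually.of_forall fun t => ?_)
  rw [real_inner_smul_left, inner_sub_left, real_inner_self_eq_norm_mul_norm]
  have h1 : ⟪S t x, x⟫_ℝ ≤ ‖x‖ * ‖x‖ :=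
    (real_inner_le_norm _ _).trans (by gcongr; exact hS t x)
  exact mul_nonpos_of_nonneg_of_nonpos (by positivity) (by linarith)

theorem IsC0Semigroup.apply_add (hS : IsC0Semigroup S) (s t : ℝ≥0) (x : X) :
    S (s + t) x = S s (S t x) := by rw [hS.map_add]; rfl

theorem InGeneratorGraph.map (hS : IsC0Semigroup S) {x y : X} (h : InGeneratorGraph S x y)
    (t : ℝ≥0) : InGeneratorGraph S (S t x) (S t y) := by
  refine (((S t).continuous.tendsto y).comp h).congr fun s => ?_
  simp only [Function.comp_apply, map_smul, map_sub]
  rw [← hS.apply_add, ← hS.apply_add, add_comm]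

theorem InGeneratorGraph.hasDerivWithinAt (hS : IsC0Semigroup S) {x y : X}
    (h : InGeneratorGraph S x y) {r : ℝ} (hr : 0 ≤ r) :
    HasDerivWithinAt (fun r : ℝ => S r.toNNReal x) (S r.toNNReal y) (Set.Ici r) r := by
  rw [hasDerivWithinAt_iff_tendsto_slope, Set.Ici_sdiff_left]
  have h1 : Tendsto (fun z : ℝ => (z - r).toNNReal) (𝓝[>] r) (𝓝[>] 0) := by
    refine tendsto_nhdsWithin_iff.2 ⟨?_, ?_⟩
    · have : Continuous fun z : ℝ => (z - r).toNNReal := by fun_prop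
      simpa using (this.tendsto r).mono_left nhdsWithin_le_nhds
    · filter_upwards [self_mem_nhdsWithin] with z hz
      exact Real.toNNReal_pos.2 (sub_pos.2 hz)
  refine ((h.map hS r.toNNReal).comp h1).congr' ?_
  filter_upwards [self_mem_nhdsWithin] with z hz
  have hz' : 0 ≤ z - r := (sub_pos.2 hz).le
  rw [Function.comp_apply, ← hS.apply_add, ← Real.toNNReal_add hz' hr, sub_add_cancel,
    Real.coe_toNNReal _ hz', slope_def_module]

variable {Γ : Submodule ℝ (X × X)}

/-- A contraction semigroup whose generator extends a maximal dissipative operator is generated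
by that operator. -/
theorem inGeneratorGraph_iff_mem (hΓ : IsMaximalDissipative Γ) (hS : ∀ t x, ‖S t x‖ ≤ ‖x‖)
    (h : ∀ p ∈ Γ, InGeneratorGraph S p.1 p.2) (u f : X) :
    InGeneratorGraph S u f ↔ (u, f) ∈ Γ := by
  refine ⟨fun huf => ?_, h (u, f)⟩
  -- With `p.1 - p.2 = u - f`, the vector `e = u - p.1 = f - p.2` has `(e, e)` in the generator
  -- graph, so dissipativity gives `‖e‖² ≤ 0`.
  obtain ⟨p, hp, hpf⟩ := hΓ.exists_sub_smul_eq 1 one_pos (u - f)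
  have h1 := (huf.sub (h p hp)).inner_nonpos hS
  have h2 : u - p.1 = f - p.2 := by
    rw [one_smul, sub_eq_sub_iff_add_eq_add] at hpf
    rw [sub_eq_sub_iff_add_eq_add, ← hpf, add_comm]
  have h3 : u - p.1 = 0 := by rwa [← h2, real_inner_self_nonpos] at h1
  rw [h3] at h2
  rw [sub_eq_zero.1 h3, sub_eq_zero.1 h2.symm]
  exact hp

/-- A strongly continuous semigroup is determined by its generator. -/
theorem IsC0Semigroup.eq_of_generator (hΓ : IsMaximalDissipative Γ) (hS : IsC0Semigroup S)
    (hT : IsC0Semigroup T) (hSΓ : ∀ u f, InGeneratorGraph S u f ↔ (u, f) ∈ Γ)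
    (hTΓ : ∀ u f, InGeneratorGraph T u f ↔ (u, f) ∈ Γ) : S = T := by
  have key : ∀ x y, (x, y) ∈ Γ → ∀ t : ℝ≥0, S t x = T t x := by
    intro x y hxy t
    let u : ℝ → X := fun r => S r.toNNReal x - T r.toNNReal x
    have hu : ContinuousOn u (Set.Icc 0 t) :=
      (((hS.continuous x).comp continuous_real_toNNReal).sub
        ((hT.continuous x).comp continuous_real_toNNReal)).continuousOn
    -- The difference of the two orbits solves `u' = A u` from the right with `u 0 = 0`, so `‖u‖²`
    -- has right derivative `2 ⟪u, A u⟫ ≤ 0` and stays zero.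
    have hu' : ∀ r ∈ Set.Ico (0 : ℝ) t, HasDerivWithinAt (fun r => ‖u r‖ ^ 2)
        (2 * ⟪u r, S r.toNNReal y - T r.toNNReal y⟫_ℝ) (Set.Ici r) r := fun r hr =>
      ((((hSΓ x y).2 hxy).hasDerivWithinAt hS hr.1).sub
        (((hTΓ x y).2 hxy).hasDerivWithinAt hT hr.1)).norm_sq
    have h0 := image_le_of_deriv_right_le_deriv_boundary (hu.norm.pow 2) hu' (B := fun _ => 0)
      (B' := fun _ => 0) (by simp [u, hS.map_zero, hT.map_zero]) continuousOn_const
      (fun r _ => (hasDerivWithinAt_const _ _ _)) (fun r hr => by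
        have h1 := Γ.sub_mem ((hSΓ _ _).1 (((hSΓ x y).2 hxy).map hS r.toNNReal))
          ((hTΓ _ _).1 (((hTΓ x y).2 hxy).map hT r.toNNReal))
        have h2 := hΓ.inner_nonpos _ h1
        rw [real_inner_comm] at h2
        have h3 : ⟪u r, S r.toNNReal y - T r.toNNReal y⟫_ℝ ≤ 0 := h2
        linarith) ⟨t.2, le_rfl⟩
    have h1 : ‖u t‖ = 0 := by
      have := sq_nonneg ‖u t‖
      exact pow_eq_zero_iff two_ne_zero |>.1 (le_antisymm h0 this)
    simpa [u, sub_eq_zero] using h1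
  funext t
  ext x
  exact congrFun (Continuous.ext_on hΓ.dense_domain (S t).continuous (T t).continuous
    fun z ⟨y, hz⟩ => key z y hz t) x

end Generator

/-! ### Operators associated with coercive forms -/

section Form

open scoped InnerProductSpace

variable {V H : Type*} [NormedAddCommGroup V] [InnerProductSpace ℝ V]
  [NormedAddCommGroup H] [InnerProductSpace ℝ H]

/-- The graph of the operator associated with the bilinear form `b` on `V`. -/
def formGraph (ι : V →L[ℝ] H) (b : V →L[ℝ] V →L[ℝ] ℝ) : Submodule ℝ (H × H) where
  carrier := {x | ∃ p, ι p = x.1 ∧ ∀ q, b p q = -⟪x.2, ι q⟫_ℝ}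
  zero_mem' := ⟨0, by simp, by simp⟩
  add_mem' := by
    rintro x y ⟨p, hp, hp'⟩ ⟨q, hq, hq'⟩
    refine ⟨p + q, by simp [hp, hq], fun v => ?_⟩
    rw [map_add, add_apply, hp', hq', Prod.snd_add, inner_add_left]; ring
  smul_mem' := by
    rintro c x ⟨p, hp, hp'⟩
    refine ⟨c • p, by simp [hp], fun v => ?_⟩
    rw [map_smul, smul_apply, hp', Prod.smul_snd, real_inner_smul_left, smul_eq_mul]; ring

theorem mem_formGraph {ι : V →L[ℝ] H} {b : V →L[ℝ] V →L[ℝ] ℝ} {u f : H} :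
    (u, f) ∈ formGraph ι b ↔ ∃ p, ι p = u ∧ ∀ q, b p q = -⟪f, ι q⟫_ℝ := Iff.rfl

/-- Lax–Milgram for the form `⟪ι p, ι q⟫ + ε b p q`, which is coercive with constant `min 1 ε * c`;
the right-hand side is represented in `V` by the adjoint of `ι` applied to `f`. -/
theorem exists_form_eq [CompleteSpace V] [CompleteSpace H] (ι : V →L[ℝ] H)
    (b : V →L[ℝ] V →L[ℝ] ℝ) (hb : ∀ p, 0 ≤ b p p) {c : ℝ} (hc : 0 < c)
    (hcoer : ∀ p, c * ‖p‖ ^ 2 ≤ ‖ι p‖ ^ 2 + b p p) {ε : ℝ} (hε : 0 < ε) (f : H) :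
    ∃ p, ∀ q, ⟪ι p, ι q⟫_ℝ + ε * b p q = ⟪f, ι q⟫_ℝ := by
  let i : H →L[ℝ] H →L[ℝ] ℝ :=
    (isBoundedBilinearMap_inner (𝕜 := ℝ) (E := H)).toContinuousLinearMap
  have hi : ∀ x y, i x y = ⟪x, y⟫_ℝ := fun x y => rfl
  let B : V →L[ℝ] V →L[ℝ] ℝ := i.bilinearComp ι ι + ε • b
  have hB : ∀ p q, B p q = ⟪ι p, ι q⟫_ℝ + ε * b p q := fun p q => rfl
  have hcB : IsCoercive B := by
    refine ⟨min 1 ε * c, by positivity, fun p => ?_⟩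
    rw [hB, real_inner_self_eq_norm_sq, mul_assoc, mul_assoc, ← sq]
    calc min 1 ε * (c * ‖p‖ ^ 2) ≤ min 1 ε * (‖ι p‖ ^ 2 + b p p) := by gcongr; exact hcoer p
      _ = min 1 ε * ‖ι p‖ ^ 2 + min 1 ε * b p p := by ring
      _ ≤ 1 * ‖ι p‖ ^ 2 + ε * b p p := by
        gcongr
        · exact min_le_left _ _
        · exact hb p
        · exact min_le_right _ _
      _ = _ := by ring
  refine ⟨hcB.continuousLinearEquivOfBilin.symm (ContinuousLinearMap.adjoint ι f), fun q => ?_⟩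
  rw [← hB, ← hcB.continuousLinearEquivOfBilin_apply, ContinuousLinearEquiv.apply_symm_apply,
    ContinuousLinearMap.adjoint_inner_left]

theorem isMaximalDissipative_formGraph [CompleteSpace V] [CompleteSpace H] (ι : V →L[ℝ] H)
    (b : V →L[ℝ] V →L[ℝ] ℝ) (hb : ∀ p, 0 ≤ b p p) {c : ℝ} (hc : 0 < c)
    (hcoer : ∀ p, c * ‖p‖ ^ 2 ≤ ‖ι p‖ ^ 2 + b p p)
    (hdense : ∀ f : H, (∀ q, ⟪f, ι q⟫_ℝ = 0) → f = 0) :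
    IsMaximalDissipative (formGraph ι b) := by
  have hrange : ∀ ε : ℝ, 0 < ε → ∀ f : H, ∃ p,
      (ι p, ε⁻¹ • (ι p - f)) ∈ formGraph ι b ∧ ∀ q, ⟪ι p, ι q⟫_ℝ + ε * b p q = ⟪f, ι q⟫_ℝ := by
    intro ε hε f
    obtain ⟨p, hp⟩ := exists_form_eq ι b hb hc hcoer hε f
    refine ⟨p, ⟨p, rfl, fun q => ?_⟩, hp⟩
    rw [real_inner_smul_left, inner_sub_left, ← hp q]
    field_simp
    ring
  refine ⟨?_, fun ε hε f => ?_, ?_⟩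
  · rintro ⟨u, f⟩ ⟨p, rfl, hp⟩
    have := hp p
    have := hb p
    dsimp only at *
    linarith
  · obtain ⟨p, hp, -⟩ := hrange ε hε f
    exact ⟨_, hp, by simp [smul_inv_smul₀ hε.ne']⟩
  · let D : Submodule ℝ H := (formGraph ι b).map (LinearMap.fst ℝ H H)
    have hD : (D : Set H) = {x : H | ∃ y, (x, y) ∈ formGraph ι b} := by
      ext x
      simp [D]
    rw [← hD, Submodule.dense_iff_topologicalClosure_eq_top,
      Submodule.topologicalClosure_eq_top_iff, Submodule.eq_bot_iff]
    intro f hf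
    -- If `f` is orthogonal to the domain, testing the equation `p - A p = f` with `p` itself gives
    -- `‖ι p‖² + b p p = 0`. Hence `p = 0`, and `f` annihilates the range of `ι`.
    obtain ⟨p, hp, hpf⟩ := hrange 1 one_pos f
    have h1 : ⟪f, ι p⟫_ℝ = 0 := by
      rw [real_inner_comm]
      exact hf _ ⟨_, hp, rfl⟩
    have h2 := hpf p
    rw [h1, real_inner_self_eq_norm_sq, one_mul] at h2
    have h3 : ‖p‖ ^ 2 ≤ 0 := by nlinarith [hcoer p]
    have h4 : p = 0 := by
      rw [← norm_eq_zero]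
      exact pow_eq_zero_iff two_ne_zero |>.1 (le_antisymm h3 (sq_nonneg _))
    refine hdense f fun q => ?_
    rw [← hpf q, h4]
    simp

end Form

/-! ### Inner products and multiplication operators on `L²` -/

section MulL2

open scoped InnerProductSpace

variable {α : Type*} [MeasurableSpace α] {μ : Measure α}

theorem L2_inner_eq (f g : Lp ℝ 2 μ) : ⟪f, g⟫_ℝ = ∫ a, f a * g a ∂μ := by
  rw [L2.inner_def]
  simp only [RCLike.inner_apply, conj_trivial, mul_comm]

theorem L2_integrable_mul (f g : Lp ℝ 2 μ) : Integrable (fun a => f a * g a) μ :=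
  (L2.integrable_inner (𝕜 := ℝ) f g).congr (Eventually.of_forall fun a => by
    simp only [RCLike.inner_apply, conj_trivial, mul_comm])

theorem L2_norm_sq_eq (f : Lp ℝ 2 μ) : ‖f‖ ^ 2 = ∫ a, f a ^ 2 ∂μ := by
  rw [← real_inner_self_eq_norm_sq, L2_inner_eq]
  simp only [sq]

theorem L2_integrable_sq (f : Lp ℝ 2 μ) : Integrable (fun a => f a ^ 2) μ := by
  simpa only [sq] using L2_integrable_mul f f

theorem integral_mul_eq_inner_toLp {ψ : α → ℝ} (hψ : MemLp ψ 2 μ) (u : Lp ℝ 2 μ) :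
    ∫ a, u a * ψ a ∂μ = ⟪u, hψ.toLp ψ⟫_ℝ := by
  rw [L2_inner_eq]
  refine integral_congr_ae ?_
  filter_upwards [hψ.coeFn_toLp] with a ha
  rw [ha]

/-- Multiplication by a bounded measurable function is a bounded operator on `L²`. -/
theorem exists_clm_mul {ψ : α → ℝ} (hψ : AEStronglyMeasurable ψ μ) {M : ℝ}
    (hM : ∀ᵐ a ∂μ, |ψ a| ≤ M) :
    ∃ T : Lp ℝ 2 μ →L[ℝ] Lp ℝ 2 μ, ∀ w, T w =ᵐ[μ] fun a => ψ a * w a := by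
  have hmem : ∀ w : Lp ℝ 2 μ, MemLp (fun a => ψ a * w a) 2 μ := fun w =>
    (Lp.memLp w).of_le_mul (hψ.mul (Lp.aestronglyMeasurable w)) (c := M) <| by
      filter_upwards [hM] with a ha
      rw [norm_mul]
      exact mul_le_mul_of_nonneg_right ha (norm_nonneg _)
  have hcoe : ∀ w, (hmem w).toLp _ =ᵐ[μ] fun a => ψ a * w a := fun w => (hmem w).coeFn_toLp
  let T₀ : Lp ℝ 2 μ →ₗ[ℝ] Lp ℝ 2 μ :=
    { toFun := fun w => (hmem w).toLp _
      map_add' := fun w z => by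
        ext1
        filter_upwards [hcoe (w + z), hcoe w, hcoe z, Lp.coeFn_add w z,
          Lp.coeFn_add ((hmem w).toLp _) ((hmem z).toLp _)] with a h1 h2 h3 h4 h5
        rw [h1, h4, h5, Pi.add_apply, Pi.add_apply, h2, h3, mul_add]
      map_smul' := fun c w => by
        ext1
        filter_upwards [hcoe (c • w), hcoe w, Lp.coeFn_smul c w,
          Lp.coeFn_smul c ((hmem w).toLp _)] with a h1 h2 h3 h4
        rw [h1, h3, RingHom.id_apply, h4, Pi.smul_apply, Pi.smul_apply, h2, smul_eq_mul,
          smul_eq_mul]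
        ring }
  refine ⟨T₀.mkContinuous M fun w => Lp.norm_le_mul_norm_of_ae_le_mul ?_, hcoe⟩
  filter_upwards [hM, hcoe w] with a ha ha'
  change ‖((hmem w).toLp _ : Lp ℝ 2 μ) a‖ ≤ _
  rw [ha', norm_mul]
  exact mul_le_mul_of_nonneg_right ha (norm_nonneg _)

end MulL2

/-! ### The Hilbert space `H¹(O)` -/

section Sobolev

open scoped InnerProductSpace

variable {d : ℕ} {O : Set (EuclideanSpace ℝ (Fin d))}

theorem integral_mul_fderiv_of_hasCompactSupport {f φ : EuclideanSpace ℝ (Fin d) → ℝ}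
    (hf : ContDiff ℝ 1 f) (hφ : ContDiff ℝ 1 φ) (hφc : HasCompactSupport φ)
    (e : EuclideanSpace ℝ (Fin d)) :
    ∫ ξ, f ξ * fderiv ℝ φ ξ e = -∫ ξ, fderiv ℝ f ξ e * φ ξ := by
  have hf' : Continuous fun ξ => fderiv ℝ f ξ e :=
    (hf.continuous_fderiv one_ne_zero).clm_apply continuous_const
  have hφ' : Continuous fun ξ => fderiv ℝ φ ξ e :=
    (hφ.continuous_fderiv one_ne_zero).clm_apply continuous_const
  refine integral_mul_fderiv_eq_neg_fderiv_mul_of_integrable ?_ ?_ ?_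
    (fun ξ _ => hf.differentiable one_ne_zero ξ) (fun ξ _ => hφ.differentiable one_ne_zero ξ)
  · exact (hf'.mul hφ.continuous).integrable_of_hasCompactSupport hφc.mul_left
  · exact (hf.continuous.mul hφ').integrable_of_hasCompactSupport
      (hφc.fderiv_apply ℝ e).mul_left
  · exact (hf.continuous.mul hφ.continuous).integrable_of_hasCompactSupport hφc.mul_left

theorem memLp_two_of_hasCompactSupport {φ : EuclideanSpace ℝ (Fin d) → ℝ} (hφ : ContDiff ℝ ∞ φ)
    (hφc : HasCompactSupport φ) : MemLp φ 2 (volume.restrict O) :=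
  hφ.continuous.memLp_of_hasCompactSupport hφc

theorem memLp_two_fderiv_of_hasCompactSupport {φ : EuclideanSpace ℝ (Fin d) → ℝ}
    (hφ : ContDiff ℝ ∞ φ) (hφc : HasCompactSupport φ) (e : EuclideanSpace ℝ (Fin d)) :
    MemLp (fun ξ => fderiv ℝ φ ξ e) 2 (volume.restrict O) :=
  Continuous.memLp_of_hasCompactSupport
    ((hφ.continuous_fderiv (by simp)).clm_apply continuous_const) (hφc.fderiv_apply ℝ e)

theorem setIntegral_mul_test {φ : EuclideanSpace ℝ (Fin d) → ℝ} (hφO : tsupport φ ⊆ O)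
    (f : EuclideanSpace ℝ (Fin d) → ℝ) : ∫ ξ in O, f ξ * φ ξ = ∫ ξ, f ξ * φ ξ :=
  setIntegral_eq_integral_of_forall_compl_eq_zero fun ξ hξ => by
    rw [image_eq_zero_of_notMem_tsupport fun h => hξ (hφO h), mul_zero]

variable (O) in
/-- The Hilbert space `L²(O) × L²(O)^d`. -/
abbrev L2Pair : Type := WithLp 2 (L2 O × PiLp 2 fun _ : Fin d => L2 O)

variable (O) in
/-- The Sobolev space `H¹(O)`, as the space of pairs `(u, ∇u)`. -/
noncomputable def sobolev : Submodule ℝ (L2Pair O) where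
  carrier := {p | IsWeakGradient p.fst p.snd}
  zero_mem' := fun φ hφ hφc _ i => by
    rw [integral_mul_eq_inner_toLp (memLp_two_fderiv_of_hasCompactSupport hφ hφc _),
      integral_mul_eq_inner_toLp (memLp_two_of_hasCompactSupport hφ hφc)]
    simp
  add_mem' := fun {p q} hp hq φ hφ hφc hφO i => by
    have h1 := hp φ hφ hφc hφO i
    have h2 := hq φ hφ hφc hφO i
    rw [integral_mul_eq_inner_toLp (memLp_two_fderiv_of_hasCompactSupport hφ hφc _),
      integral_mul_eq_inner_toLp (memLp_two_of_hasCompactSupport hφ hφc)] at *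
    rw [WithLp.add_fst, WithLp.add_snd, PiLp.add_apply, inner_add_left, inner_add_left, h1, h2]
    ring
  smul_mem' := fun c {p} hp φ hφ hφc hφO i => by
    have h1 := hp φ hφ hφc hφO i
    rw [integral_mul_eq_inner_toLp (memLp_two_fderiv_of_hasCompactSupport hφ hφc _),
      integral_mul_eq_inner_toLp (memLp_two_of_hasCompactSupport hφ hφc)] at *
    rw [WithLp.smul_fst, WithLp.smul_snd, PiLp.smul_apply, real_inner_smul_left,
      real_inner_smul_left, h1]
    ring

/-- For each test function, the defining identity compares inner products with fixed elements of
`L²(O)`, so it is a closed condition on `(u, ∇u)`. -/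
theorem isClosed_sobolev : IsClosed (sobolev O : Set (L2Pair O)) := by
  have : (sobolev O : Set (L2Pair O)) = {p | IsWeakGradient p.fst p.snd} := rfl
  rw [this]
  simp only [IsWeakGradient, Set.ofPred_forall]
  refine isClosed_iInter fun φ => isClosed_iInter fun hφ => isClosed_iInter fun hφc =>
    isClosed_iInter fun _ => isClosed_iInter fun i => ?_
  simp only [integral_mul_eq_inner_toLp (memLp_two_fderiv_of_hasCompactSupport hφ hφc _),
    integral_mul_eq_inner_toLp (memLp_two_of_hasCompactSupport hφ hφc)]
  have h1 : Continuous fun p : L2Pair O => p.fst :=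
    (WithLp.fstL 2 ℝ (L2 O) (PiLp 2 fun _ : Fin d => L2 O)).continuous
  have h2 : Continuous fun p : L2Pair O => p.snd i :=
    ((PiLp.proj 2 (fun _ : Fin d => L2 O) i).comp
      (WithLp.sndL 2 ℝ (L2 O) (PiLp 2 fun _ : Fin d => L2 O))).continuous
  exact isClosed_eq (h1.inner continuous_const) (h2.inner continuous_const).neg

variable (O) in
/-- The Sobolev space `H¹(O)` as a Hilbert space. -/
def H1 : Type := sobolev O

noncomputable instance : NormedAddCommGroup (H1 O) :=
  inferInstanceAs (NormedAddCommGroup (sobolev O))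

noncomputable instance : InnerProductSpace ℝ (H1 O) :=
  inferInstanceAs (InnerProductSpace ℝ (sobolev O))

instance : CompleteSpace (H1 O) := isClosed_sobolev.completeSpace_coe

variable (O) in
/-- The inclusion `H¹(O) → L²(O) × L²(O)^d`. -/
noncomputable def H1.toPair : H1 O →L[ℝ] L2Pair O := (sobolev O).subtypeL

/-- The inclusion `H¹(O) → L²(O)`. -/
noncomputable def sobolevVal : H1 O →L[ℝ] L2 O :=
  (WithLp.fstL 2 ℝ (L2 O) (PiLp 2 fun _ : Fin d => L2 O)).comp (H1.toPair O)

/-- The partial derivative `∂ᵢ : H¹(O) → L²(O)`. -/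
noncomputable def sobolevGrad (i : Fin d) : H1 O →L[ℝ] L2 O :=
  ((PiLp.proj 2 (fun _ : Fin d => L2 O) i).comp
    (WithLp.sndL 2 ℝ (L2 O) (PiLp 2 fun _ : Fin d => L2 O))).comp (H1.toPair O)

theorem isWeakGradient_sobolev (p : H1 O) :
    IsWeakGradient (sobolevVal p) fun i => sobolevGrad i p := p.2

theorem IsWeakGradient.exists_sobolev {u : L2 O} {w : Fin d → L2 O} (h : IsWeakGradient u w) :
    ∃ p : H1 O, sobolevVal p = u ∧ ∀ i, sobolevGrad i p = w i :=
  ⟨⟨WithLp.toLp 2 (u, WithLp.toLp 2 w), h⟩, rfl, fun _ => rfl⟩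

theorem norm_sobolev_sq (p : H1 O) :
    ‖p‖ ^ 2 = ‖sobolevVal p‖ ^ 2 + ∑ i, ‖sobolevGrad i p‖ ^ 2 := by
  rw [show ‖p‖ = ‖H1.toPair O p‖ from rfl, WithLp.prod_norm_sq_eq_of_L2,
    PiLp.norm_sq_eq_of_L2]
  rfl

theorem isWeakGradient_toLp {φ : EuclideanSpace ℝ (Fin d) → ℝ} (hφ : ContDiff ℝ ∞ φ)
    (hφc : HasCompactSupport φ) :
    IsWeakGradient ((memLp_two_of_hasCompactSupport hφ hφc).toLp φ : L2 O) fun i =>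
      (memLp_two_fderiv_of_hasCompactSupport hφ hφc (EuclideanSpace.single i 1)).toLp _ := by
  intro ψ hψ hψc hψO i
  have h1 : ∫ ξ in O, (memLp_two_of_hasCompactSupport (O := O) hφ hφc).toLp φ ξ *
      fderiv ℝ ψ ξ (EuclideanSpace.single i 1) =
      ∫ ξ in O, φ ξ * fderiv ℝ ψ ξ (EuclideanSpace.single i 1) := by
    refine integral_congr_ae ?_
    filter_upwards [(memLp_two_of_hasCompactSupport (O := O) hφ hφc).coeFn_toLp] with ξ hξ
    rw [hξ]
  have h2 : ∫ ξ in O, (memLp_two_fderiv_of_hasCompactSupport (O := O) hφ hφc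
      (EuclideanSpace.single i 1)).toLp _ ξ * ψ ξ =
      ∫ ξ in O, fderiv ℝ φ ξ (EuclideanSpace.single i 1) * ψ ξ := by
    refine integral_congr_ae ?_
    filter_upwards [(memLp_two_fderiv_of_hasCompactSupport (O := O) hφ hφc
      (EuclideanSpace.single i 1)).coeFn_toLp] with ξ hξ
    rw [hξ]
  rw [h1, h2, setIntegral_mul_test hψO,
    setIntegral_mul_test ((tsupport_fderiv_apply_subset ℝ _).trans hψO)]
  exact integral_mul_fderiv_of_hasCompactSupport (hφ.of_le (by simp)) (hψ.of_le (by simp)) hψc _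

/-- `H¹(O)` is dense in `L²(O)`. -/
theorem eq_zero_of_inner_sobolevVal (hO : IsOpen O) (f : L2 O)
    (h : ∀ q : H1 O, ⟪f, sobolevVal q⟫_ℝ = 0) : f = 0 := by
  have h1 : ∀ᵐ ξ, ξ ∈ O → f ξ = 0 := by
    refine hO.ae_eq_zero_of_integral_contDiff_smul_eq_zero ?_ fun φ hφ hφc hφO => ?_
    · have h2 : MemLp f 2 (volume.restrict O) := Lp.memLp f
      exact (locallyIntegrableOn_of_locallyIntegrable_restrict
        (h2.locallyIntegrable (by norm_num)))
    · obtain ⟨q, hq, -⟩ := (isWeakGradient_toLp (O := O) hφ hφc).exists_sobolev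
      have h2 := h q
      rw [hq, ← integral_mul_eq_inner_toLp, setIntegral_mul_test hφO] at h2
      simpa [mul_comm] using h2
  ext1
  rw [← ae_restrict_iff' hO.measurableSet] at h1
  filter_upwards [h1, Lp.coeFn_zero ℝ 2 (volume.restrict O)] with ξ h2 h3
  rw [h2, h3]; rfl

end Sobolev

/-! ### The Dirichlet form and the conormal realization -/

section Conormal

open scoped InnerProductSpace

variable {d : ℕ} {O : Set (EuclideanSpace ℝ (Fin d))}
  {a : EuclideanSpace ℝ (Fin d) → Matrix (Fin d) (Fin d) ℝ}

theorem IsEllipticCoefficient.exists_mul (hO : IsBoundedDomain O) (ha : IsEllipticCoefficient O a) :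
    ∃ T : Fin d → Fin d → L2 O →L[ℝ] L2 O, ∀ i j w, T i j w =ᵐ[volume.restrict O]
      fun ξ => a ξ i j * w ξ := by
  choose T hT using fun i j => (show ∃ T : L2 O →L[ℝ] L2 O, ∀ w, T w =ᵐ[volume.restrict O]
      fun ξ => a ξ i j * w ξ by
    have hc := (ha.contDiffOn i j).continuousOn
    obtain ⟨M, hM⟩ := hO.isBounded.isCompact_closure.exists_bound_of_continuousOn hc
    refine exists_clm_mul (M := M)
      ((hc.mono subset_closure).aestronglyMeasurable hO.isOpen.measurableSet) ?_
    filter_upwards [ae_restrict_mem hO.isOpen.measurableSet] with ξ hξ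
    exact hM ξ (subset_closure hξ))
  exact ⟨T, hT⟩

/-- The Dirichlet form `(u, v) ↦ ∫ ⟨a ∇u, ∇v⟩` is bounded on `H¹(O)`. -/
theorem IsEllipticCoefficient.exists_form (hO : IsBoundedDomain O)
    (ha : IsEllipticCoefficient O a) :
    ∃ b : H1 O →L[ℝ] H1 O →L[ℝ] ℝ, ∀ p q, Integrable (fun ξ =>
      ∑ i, ∑ j, a ξ i j * sobolevGrad j p ξ * sobolevGrad i q ξ) (volume.restrict O) ∧
      b p q = ∫ ξ in O, ∑ i, ∑ j, a ξ i j * sobolevGrad j p ξ * sobolevGrad i q ξ := by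
  obtain ⟨T, hT⟩ := ha.exists_mul hO
  let m : L2 O →L[ℝ] L2 O →L[ℝ] ℝ :=
    (isBoundedBilinearMap_inner (𝕜 := ℝ) (E := L2 O)).toContinuousLinearMap
  let b : H1 O →L[ℝ] H1 O →L[ℝ] ℝ :=
    ∑ i, ∑ j, m.bilinearComp ((T i j).comp (sobolevGrad j)) (sobolevGrad i)
  have hb : ∀ p q, b p q = ∑ i, ∑ j, ⟪T i j (sobolevGrad j p), sobolevGrad i q⟫_ℝ := by
    intro p q
    simp only [b, sum_apply]
    rfl
  refine ⟨b, fun p q => ?_⟩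
  have h1 : ∀ i j, (fun ξ => T i j (sobolevGrad j p) ξ * sobolevGrad i q ξ)
      =ᵐ[volume.restrict O] fun ξ => a ξ i j * sobolevGrad j p ξ * sobolevGrad i q ξ := by
    intro i j
    filter_upwards [hT i j (sobolevGrad j p)] with ξ hξ
    rw [hξ]
  have h2 : ∀ i j, Integrable (fun ξ => a ξ i j * sobolevGrad j p ξ * sobolevGrad i q ξ)
      (volume.restrict O) := fun i j => (L2_integrable_mul _ _).congr (h1 i j)
  refine ⟨integrable_finsetSum _ fun i _ => integrable_finsetSum _ fun j _ => h2 i j, ?_⟩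
  rw [hb, integral_finsetSum _ fun i _ => integrable_finsetSum _ fun j _ => h2 i j]
  refine Finset.sum_congr rfl fun i _ => ?_
  rw [integral_finsetSum _ fun j _ => h2 i j]
  refine Finset.sum_congr rfl fun j _ => ?_
  rw [L2_inner_eq]
  exact integral_congr_ae (h1 i j)

theorem isMaximalDissipative_sobolev (hO : IsOpen O) {a₀ : ℝ} (ha₀ : 0 < a₀)
    {b : H1 O →L[ℝ] H1 O →L[ℝ] ℝ}
    (hb : ∀ p, a₀ * ∑ i, ‖sobolevGrad i p‖ ^ 2 ≤ b p p) :
    IsMaximalDissipative (formGraph sobolevVal b) := by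
  have h0 : ∀ p : H1 O, 0 ≤ ∑ i, ‖sobolevGrad i p‖ ^ 2 := fun p =>
    Finset.sum_nonneg fun i _ => sq_nonneg _
  refine isMaximalDissipative_formGraph sobolevVal b (fun p => ?_)
    (lt_min one_pos ha₀) (fun p => ?_) (eq_zero_of_inner_sobolevVal hO)
  · exact (mul_nonneg ha₀.le (h0 p)).trans (hb p)
  · rw [norm_sobolev_sq, mul_add]
    have h2 := mul_le_mul_of_nonneg_right (min_le_left 1 a₀) (sq_nonneg ‖sobolevVal p‖)
    have h3 := mul_le_mul_of_nonneg_right (min_le_right 1 a₀) (h0 p)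
    have h4 := hb p
    linarith

theorem mem_formGraph_sobolev_iff {b : H1 O →L[ℝ] H1 O →L[ℝ] ℝ}
    (hb : ∀ p q, b p q =
      ∫ ξ in O, ∑ i, ∑ j, a ξ i j * sobolevGrad j p ξ * sobolevGrad i q ξ) (u f : L2 O) :
    (u, f) ∈ formGraph sobolevVal b ↔ IsConormalRealization a u f := by
  rw [mem_formGraph]
  constructor
  · rintro ⟨p, rfl, hp⟩
    refine ⟨_, isWeakGradient_sobolev p, fun v z hvz => ?_⟩
    obtain ⟨q, rfl, hq⟩ := hvz.exists_sobolev
    simp only [← hq]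
    rw [← hb p q, hp q, L2_inner_eq]
  · rintro ⟨w, hw, h⟩
    obtain ⟨p, hp, hpw⟩ := hw.exists_sobolev
    refine ⟨p, hp, fun q => ?_⟩
    have := h _ _ (isWeakGradient_sobolev q)
    simp only [← hpw] at this
    rw [hb p q, this, L2_inner_eq]

/-- The conormal realization is the operator of the Dirichlet form on `H¹(O)`, hence maximal
dissipative. -/
theorem exists_isMaximalDissipative_conormal (hO : IsBoundedDomain O)
    (ha : IsEllipticCoefficient O a) :
    ∃ Γ : Submodule ℝ (L2 O × L2 O), IsMaximalDissipative Γ ∧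
      ∀ u f, (u, f) ∈ Γ ↔ IsConormalRealization a u f := by
  obtain ⟨b, hb⟩ := ha.exists_form hO
  obtain ⟨a₀, ha₀, hell⟩ := ha.elliptic
  refine ⟨formGraph sobolevVal b, isMaximalDissipative_sobolev hO.isOpen ha₀ fun p => ?_,
    mem_formGraph_sobolev_iff fun p q => (hb p q).2⟩
  have h1 : a₀ * ∑ i, ‖sobolevGrad i p‖ ^ 2 =
      ∫ ξ in O, a₀ * ∑ i, sobolevGrad i p ξ ^ 2 := by
    rw [integral_const_mul, integral_finsetSum _ fun i _ => L2_integrable_sq _]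
    simp only [L2_norm_sq_eq]
  rw [h1, (hb p p).2]
  refine integral_mono_ae ?_ (hb p p).1 ?_
  · exact (integrable_finsetSum _ fun i _ => L2_integrable_sq _).const_mul _
  · filter_upwards [ae_restrict_mem hO.isOpen.measurableSet] with ξ hξ
    refine (hell ξ (subset_closure hξ) fun i => sobolevGrad i p ξ).trans (le_of_eq ?_)
    exact Finset.sum_congr rfl fun i _ => Finset.sum_congr rfl fun j _ => by ring

end Conormal

/-- Almost everywhere convergence together with an upper bound for the limit of the `L¹` norms
gives convergence in `L¹`. -/
theorem tendsto_integral_abs_sub_zero {α : Type*} [MeasurableSpace α] {μ : Measure α}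
    {F : ℕ → α → ℝ} {f : α → ℝ} (hF : ∀ n, Integrable (F n) μ) (hf : Integrable f μ)
    (hle : ∀ n, ∫ a, |F n a| ∂μ ≤ ∫ a, |f a| ∂μ)
    (hlim : ∀ᵐ a ∂μ, Tendsto (fun n => F n a) atTop (𝓝 (f a))) :
    Tendsto (fun n => ∫ a, |F n a - f a| ∂μ) atTop (𝓝 0) := by
  -- Scheffé's device: this integrand is dominated by `2 * |f|` even though no common bound for the
  -- `F n` is available.
  have hG : Tendsto (fun n => ∫ a, (|F n a| + |f a| - |F n a - f a|) ∂μ) atTop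
      (𝓝 (∫ a, 2 * |f a| ∂μ)) := by
    refine tendsto_integral_of_dominated_convergence (fun a => 2 * |f a|)
      (fun n => (((hF n).abs.add hf.abs).sub ((hF n).sub hf).abs).aestronglyMeasurable)
      (hf.abs.const_mul 2) (fun n => Eventually.of_forall fun a => ?_) ?_
    · rw [Real.norm_eq_abs, abs_le]
      have h1 := abs_sub (F n a) (f a)
      have h2 := abs_sub_abs_le_abs_sub (F n a) (f a)
      constructor <;> linarith [abs_nonneg (f a)]
    · filter_upwards [hlim] with a ha
      have h1 := (ha.abs.add_const |f a|).sub (ha.sub_const (f a)).abs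
      simpa [two_mul] using h1
  have h2 : Tendsto (fun n => 2 * ∫ a, |f a| ∂μ - ∫ a, (|F n a| + |f a| - |F n a - f a|) ∂μ) atTop
      (𝓝 0) := by
    rw [integral_const_mul] at hG
    simpa using hG.const_sub (2 * ∫ a, |f a| ∂μ)
  refine squeeze_zero (fun n => integral_nonneg fun a => abs_nonneg _) (fun n => ?_) h2
  have h3 : ∫ a, (|F n a| + |f a| - |F n a - f a|) ∂μ =
      ∫ a, (|F n a| + |f a|) ∂μ - ∫ a, |F n a - f a| ∂μ :=
    integral_sub ((hF n).abs.add hf.abs) ((hF n).sub hf).abs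
  have h4 : ∫ a, (|F n a| + |f a|) ∂μ = ∫ a, |F n a| ∂μ + ∫ a, |f a| ∂μ :=
    integral_add (hF n).abs hf.abs
  linarith [hle n]

theorem tendsto_integral_of_abs_sub_le {α : Type*} [MeasurableSpace α] {μ : Measure α}
    {F G : ℕ → α → ℝ} {f : α → ℝ} (hF : ∀ n, Integrable (F n) μ) (hf : Integrable f μ)
    (hG : ∀ n, Integrable (G n) μ) (hle : ∀ n a, |F n a - f a| ≤ G n a)
    (hlim : Tendsto (fun n => ∫ a, G n a ∂μ) atTop (𝓝 0)) :
    Tendsto (fun n => ∫ a, F n a ∂μ) atTop (𝓝 (∫ a, f a ∂μ)) := by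
  rw [tendsto_iff_norm_sub_tendsto_zero]
  refine squeeze_zero (fun n => norm_nonneg _) (fun n => ?_) hlim
  rw [← integral_sub (hF n) hf]
  exact norm_integral_le_of_norm_le (hG n) (Eventually.of_forall (hle n))

/-! ### Mollification on `ℝ^d` -/

section Mollify

open ContinuousLinearMap

variable {d : ℕ} {U : EuclideanSpace ℝ (Fin d) → ℝ}

/-- Mollification of `U` by the normalized bump function `ρ`. -/
noncomputable def mollify (ρ : ContDiffBump (0 : EuclideanSpace ℝ (Fin d)))
    (U : EuclideanSpace ℝ (Fin d) → ℝ) : EuclideanSpace ℝ (Fin d) → ℝ :=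
  convolution (ρ.normed volume) U (lsmul ℝ ℝ) volume

variable (ρ : ContDiffBump (0 : EuclideanSpace ℝ (Fin d)))

theorem mollify_eq (U : EuclideanSpace ℝ (Fin d) → ℝ) (x : EuclideanSpace ℝ (Fin d)) :
    mollify ρ U x = ∫ t, ρ.normed volume (x - t) * U t :=
  convolution_eq_swap _

theorem integrable_normed : Integrable (ρ.normed volume) :=
  ρ.continuous_normed.integrable_of_hasCompactSupport ρ.hasCompactSupport_normed

theorem integrable_mollify (hU : Integrable U) : Integrable (mollify ρ U) :=
  (integrable_normed ρ).integrable_convolution _ hU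

theorem integral_abs_mollify_le (hU : Integrable U) :
    ∫ x, |mollify ρ U x| ≤ ∫ x, |U x| := by
  have h1 : ∫ x, mollify ρ (fun x => |U x|) x = ∫ x, |U x| := by
    have := integral_convolution (lsmul ℝ ℝ) (integrable_normed ρ) hU.abs
    rw [ρ.integral_normed] at this
    simpa [mollify] using this
  rw [← h1]
  refine integral_mono (integrable_mollify ρ hU).abs (integrable_mollify ρ hU.abs) fun x => ?_
  dsimp only
  rw [mollify_eq, mollify_eq, ← Real.norm_eq_abs]
  refine (norm_integral_le_integral_norm _).trans (le_of_eq ?_)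
  refine integral_congr_ae (Eventually.of_forall fun t => ?_)
  dsimp only
  rw [norm_mul, Real.norm_of_nonneg (ρ.nonneg_normed _), Real.norm_eq_abs]

theorem contDiff_mollify (hU : Integrable U) : ContDiff ℝ 1 (mollify ρ U) :=
  ρ.hasCompactSupport_normed.contDiff_convolution_left (n := 1) _ ρ.contDiff_normed
    hU.locallyIntegrable

theorem fderiv_mollify (hU : Integrable U) (x e : EuclideanSpace ℝ (Fin d)) :
    fderiv ℝ (mollify ρ U) x e = ∫ t, U t * fderiv ℝ (ρ.normed volume) (x - t) e := by
  have h0 : ContDiff ℝ 1 (ρ.normed (volume : Measure (EuclideanSpace ℝ (Fin d)))) :=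
    ρ.contDiff_normed (n := 1)
  have h1 := ρ.hasCompactSupport_normed.hasFDerivAt_convolution_left (lsmul ℝ ℝ) (μ := volume)
    h0 hU.locallyIntegrable x
  have h2 := (ρ.hasCompactSupport_normed (μ := volume)).fderiv (𝕜 := ℝ)
    |>.convolutionExists_left (precompL (EuclideanSpace ℝ (Fin d)) (lsmul ℝ ℝ))
    (h0.continuous_fderiv one_ne_zero) hU.locallyIntegrable x
  rw [mollify, h1.fderiv, convolution_eq_swap, ContinuousLinearMap.integral_apply h2.integrable_swap]
  refine integral_congr_ae (Eventually.of_forall fun t => ?_)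
  simp [mul_comm]

theorem tendsto_integral_abs_mollify_sub {ρ : ℕ → ContDiffBump (0 : EuclideanSpace ℝ (Fin d))}
    (hρ : Tendsto (fun n => (ρ n).rOut) atTop (𝓝 0)) {K : ℝ}
    (hρK : ∀ n, (ρ n).rOut ≤ K * (ρ n).rIn) (hU : Integrable U) :
    Tendsto (fun n => ∫ x, |mollify (ρ n) U x - U x|) atTop (𝓝 0) :=
  tendsto_integral_abs_sub_zero (fun _ => integrable_mollify _ hU) hU
    (fun _ => integral_abs_mollify_le _ hU)
    (ContDiffBump.ae_convolution_tendsto_right_of_locallyIntegrable hρ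
      (Eventually.of_forall hρK) hU.locallyIntegrable)

/-- The bounded ratio of radii is what almost everywhere convergence of mollifications requires. The
shift `n + 2` makes `rOut < δ` strict already at `n = 0`. -/
theorem exists_bump_seq {δ : ℝ} (hδ : 0 < δ) :
    ∃ ρ : ℕ → ContDiffBump (0 : EuclideanSpace ℝ (Fin d)),
      Tendsto (fun n => (ρ n).rOut) atTop (𝓝 0) ∧ (∀ n, (ρ n).rOut ≤ 2 * (ρ n).rIn) ∧
      ∀ n, (ρ n).rOut < δ := by
  refine ⟨fun n => ⟨δ / 2 / (n + 2), δ / (n + 2), by positivity, ?_⟩, ?_, fun n => ?_, fun n => ?_⟩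
  · rw [div_right_comm]
    exact half_lt_self (by positivity)
  · have := (tendsto_const_div_atTop_nhds_zero_nat δ).comp (tendsto_add_atTop_nat 2)
    refine this.congr fun n => ?_
    simp
  · refine le_of_eq ?_
    ring
  · exact div_lt_self hδ (by linarith [Nat.cast_nonneg (α := ℝ) n])

end Mollify

/-! ### Chain rule for weak gradients -/

section ChainRule

variable {d : ℕ} {O : Set (EuclideanSpace ℝ (Fin d))}

theorem integrable_indicator_L2 (hO : IsBoundedDomain O) (u : L2 O) : Integrable (O.indicator u) := by
  have : IsFiniteMeasure (volume.restrict O) :=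
    isFiniteMeasure_restrict.2 hO.isBounded.measure_lt_top.ne
  exact (integrable_indicator_iff hO.isOpen.measurableSet).2
    ((Lp.memLp u).integrable one_le_two)

/-- Mollification commutes with weak derivatives away from the boundary. -/
theorem IsWeakGradient.fderiv_mollify (hO : IsBoundedDomain O) {u : L2 O} {w : Fin d → L2 O}
    (hw : IsWeakGradient u w) (ρ : ContDiffBump (0 : EuclideanSpace ℝ (Fin d)))
    {x : EuclideanSpace ℝ (Fin d)} (hx : Metric.closedBall x ρ.rOut ⊆ O) (i : Fin d) :
    fderiv ℝ (mollify ρ (O.indicator u)) x (EuclideanSpace.single i 1) =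
      mollify ρ (O.indicator (w i)) x := by
  have hφ : ContDiff ℝ ∞ fun t => ρ.normed volume (x - t) :=
    (ρ.contDiff_normed (n := ⊤)).comp (contDiff_const.sub contDiff_id)
  have hsupp : tsupport (fun t => ρ.normed volume (x - t)) ⊆ Metric.closedBall x ρ.rOut := by
    refine closure_minimal (fun t ht => ?_) Metric.isClosed_closedBall
    have : x - t ∈ Function.support (ρ.normed volume) := ht
    rw [ρ.support_normed_eq, mem_ball_zero_iff] at this
    rw [Metric.mem_closedBall, dist_comm, dist_eq_norm]
    exact this.le
  have hc : HasCompactSupport fun t => ρ.normed volume (x - t) :=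
    HasCompactSupport.of_support_subset_isCompact (isCompact_closedBall x ρ.rOut)
      (subset_closure.trans hsupp)
  have hder : ∀ t, fderiv ℝ (fun t => ρ.normed volume (x - t)) t (EuclideanSpace.single i 1) =
      -fderiv ℝ (ρ.normed volume) (x - t) (EuclideanSpace.single i 1) := by
    intro t
    have h1 : HasFDerivAt (ρ.normed volume) (fderiv ℝ (ρ.normed volume) (x - t)) (x - t) :=
      ((ρ.contDiff_normed (n := 1)).differentiable one_ne_zero _).hasFDerivAt
    have h2 := h1.comp t ((hasFDerivAt_id t).const_sub x)
    have h3 : fderiv ℝ (fun t => ρ.normed volume (x - t)) t = _ := h2.fderiv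
    rw [h3]
    simp
  -- The reflected and translated bump `t ↦ ρ (x - t)` is itself a test function, being supported in
  -- a closed ball inside `O`.
  have h := hw _ hφ hc (hsupp.trans hx) i
  have hind : ∀ (v : L2 O) (f : EuclideanSpace ℝ (Fin d) → ℝ),
      ∫ t, O.indicator v t * f t = ∫ t in O, v t * f t := fun v f => by
    rw [← integral_indicator hO.isOpen.measurableSet]
    simp only [Set.indicator_mul_left]
  rw [NeumannExit.fderiv_mollify ρ (integrable_indicator_L2 hO u), mollify_eq, hind]
  simp only [mul_comm (ρ.normed volume _)]
  rw [hind]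
  simp only [hder, mul_neg, integral_neg] at h
  linarith

/-- Chain rule for weak gradients. -/
theorem IsWeakGradient.comp (hO : IsBoundedDomain O) {h : ℝ → ℝ} (hh : ContDiff ℝ 1 h) {M : ℝ}
    (hM : ∀ s, |deriv h s| ≤ M) {u : L2 O} {w : Fin d → L2 O} (hw : IsWeakGradient u w)
    {v : L2 O} {z : Fin d → L2 O} (hv : v =ᵐ[volume.restrict O] fun ξ => h (u ξ))
    (hz : ∀ i, z i =ᵐ[volume.restrict O] fun ξ => deriv h (u ξ) * w i ξ) :
    IsWeakGradient v z := by
  intro φ hφ hφc hφO i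
  set e : EuclideanSpace ℝ (Fin d) := EuclideanSpace.single i 1
  obtain ⟨δ, hδ, hδO⟩ := hφc.isCompact.exists_thickening_subset_open hO.isOpen hφO
  obtain ⟨ρ, hρ, hρK, hρδ⟩ := exists_bump_seq (d := d) hδ
  set U := O.indicator u with hUdef
  set W := O.indicator (w i) with hWdef
  have hU : Integrable U := integrable_indicator_L2 hO u
  have hW : Integrable W := integrable_indicator_L2 hO (w i)
  have hφ1 : ContDiff ℝ 1 φ := hφ.of_le (by simp)
  have hdφ : Continuous fun ξ => fderiv ℝ φ ξ e :=
    (hφ1.continuous_fderiv one_ne_zero).clm_apply continuous_const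
  have hh' : Continuous (deriv h) := hh.continuous_deriv le_rfl
  obtain ⟨B, hB⟩ := hφ.continuous.bounded_above_of_compact_support hφc
  obtain ⟨B', hB'⟩ := hdφ.bounded_above_of_compact_support (hφc.fderiv_apply ℝ e)
  have hM0 : 0 ≤ M := (abs_nonneg _).trans (hM 0)
  have hB0 : 0 ≤ B := (norm_nonneg _).trans (hB 0)
  have hB'0 : 0 ≤ B' := (norm_nonneg _).trans (hB' 0)
  have hlip : ∀ s t, |h s - h t| ≤ M * |s - t| := fun s t =>
    convex_univ.norm_image_sub_le_of_norm_deriv_le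
      (fun s _ => hh.differentiable one_ne_zero s) (fun s _ => hM s) (Set.mem_univ t)
      (Set.mem_univ s)
  have hUn := fun n => integrable_mollify (ρ n) hU
  have hWn := fun n => integrable_mollify (ρ n) hW
  -- The classical chain rule for the smoothed function. On the support of `φ` the balls of radius
  -- `rOut < δ` stay in `O`, so the gradient of the mollification is the mollified weak gradient.
  have hparts : ∀ n, ∫ ξ, h (mollify (ρ n) U ξ) * fderiv ℝ φ ξ e =
      -∫ ξ, deriv h (mollify (ρ n) U ξ) * mollify (ρ n) W ξ * φ ξ := by
    intro n
    have hc := contDiff_mollify (ρ n) hU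
    refine (integral_mul_fderiv_of_hasCompactSupport (hh.comp hc) hφ1 hφc e).trans ?_
    congr 1
    refine integral_congr_ae (Eventually.of_forall fun ξ => ?_)
    dsimp only
    by_cases hξ : ξ ∈ tsupport φ
    · have hball : Metric.closedBall ξ (ρ n).rOut ⊆ O := fun y hy =>
        hδO (Metric.mem_thickening_iff.2 ⟨ξ, hξ, lt_of_le_of_lt hy (hρδ n)⟩)
      rw [← hw.fderiv_mollify hO (ρ n) hball i]
      have h1 := ((hh.differentiable one_ne_zero _).hasDerivAt.comp_hasFDerivAt ξ
        (hc.differentiable one_ne_zero ξ).hasFDerivAt)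
      rw [h1.fderiv]
      rfl
    · rw [image_eq_zero_of_notMem_tsupport hξ, mul_zero, mul_zero]
  have hL : Tendsto (fun n => ∫ ξ, h (mollify (ρ n) U ξ) * fderiv ℝ φ ξ e) atTop
      (𝓝 (∫ ξ, h (U ξ) * fderiv ℝ φ ξ e)) := by
    have h0 : ∀ a x : ℝ, ∀ ξ, |x| ≤ M * |a| → ‖x * fderiv ℝ φ ξ e‖ ≤ M * B' * |a| :=
      fun a x ξ hx => by
        rw [norm_mul, mul_right_comm]
        exact mul_le_mul hx (hB' ξ) (norm_nonneg _) (by positivity)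
    refine tendsto_integral_of_abs_sub_le (G := fun n ξ => M * B' * |mollify (ρ n) U ξ - U ξ|)
      (fun n => ?_) ?_ (fun n => ((hUn n).sub hU).abs.const_mul _) (fun n ξ => ?_) ?_
    · exact ((hh.continuous.comp (contDiff_mollify (ρ n) hU).continuous).mul
        hdφ).integrable_of_hasCompactSupport (hφc.fderiv_apply ℝ e).mul_left
    -- Only `h (U ξ) - h 0` is controlled by `|U ξ|`; the constant `h 0` is integrable against the
    -- compactly supported derivative of `φ`.
    · have h1 : Integrable fun ξ => (h (U ξ) - h 0) * fderiv ℝ φ ξ e := by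
        refine (hU.abs.const_mul (M * B')).mono' (((hh.continuous.comp_aestronglyMeasurable
          hU.aestronglyMeasurable).sub aestronglyMeasurable_const).mul
          hdφ.aestronglyMeasurable) (Eventually.of_forall fun ξ => ?_)
        exact h0 _ _ ξ (by simpa using hlip (U ξ) 0)
      have h2 : Integrable fun ξ => h 0 * fderiv ℝ φ ξ e :=
        (hdφ.integrable_of_hasCompactSupport (hφc.fderiv_apply ℝ e)).const_mul _
      refine (h1.add h2).congr (Eventually.of_forall fun ξ => ?_)
      simp only [Pi.add_apply]
      ring
    · rw [← sub_mul]
      exact h0 _ _ ξ (hlip _ _)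
    · simpa [integral_const_mul] using
        (tendsto_integral_abs_mollify_sub hρ hρK hU).const_mul (M * B')
  have hR : Tendsto (fun n => ∫ ξ, deriv h (mollify (ρ n) U ξ) * mollify (ρ n) W ξ * φ ξ) atTop
      (𝓝 (∫ ξ, deriv h (U ξ) * W ξ * φ ξ)) := by
    have hUm : AEStronglyMeasurable (fun ξ => deriv h (U ξ)) volume :=
      hh'.comp_aestronglyMeasurable hU.aestronglyMeasurable
    have hUnm : ∀ n, AEStronglyMeasurable (fun ξ => deriv h (mollify (ρ n) U ξ)) volume := fun n =>
      hh'.comp_aestronglyMeasurable (hUn n).aestronglyMeasurable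
    have h0 : ∀ s t x : ℝ, |x| ≤ B → ‖deriv h s * t * x‖ ≤ M * B * |t| := fun s t x hx => by
      rw [norm_mul, norm_mul, mul_right_comm]
      exact mul_le_mul_of_nonneg_right (mul_le_mul (hM s) hx (norm_nonneg _) hM0) (abs_nonneg _)
    have hbd : ∀ s t, |deriv h s - deriv h t| ≤ 2 * M := fun s t =>
      (abs_sub _ _).trans (by linarith [hM s, hM t])
    have hint : ∀ n, Integrable fun ξ =>
        B * (|deriv h (mollify (ρ n) U ξ) - deriv h (U ξ)| * |W ξ|) := fun n => by
      refine Integrable.const_mul ?_ B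
      refine hW.abs.bdd_mul (c := 2 * M) ((hUnm n).sub hUm).norm
        (Eventually.of_forall fun ξ => ?_)
      simpa using hbd _ _
    -- The product error is split: convergence of the gradients in `L¹` handles the first term. In
    -- the second, `deriv h` converges only almost everywhere, and `2 * M * |W|` dominates.
    refine tendsto_integral_of_abs_sub_le (G := fun n ξ => M * B * |mollify (ρ n) W ξ - W ξ| +
        B * (|deriv h (mollify (ρ n) U ξ) - deriv h (U ξ)| * |W ξ|))
      (fun n => ?_) ?_ (fun n => (((hWn n).sub hW).abs.const_mul _).add (hint n))
      (fun n ξ => ?_) ?_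
    · exact ((hWn n).abs.const_mul (M * B)).mono' (((hUnm n).mul
        (hWn n).aestronglyMeasurable).mul hφ.continuous.aestronglyMeasurable)
        (Eventually.of_forall fun ξ => h0 _ _ _ (hB ξ))
    · exact (hW.abs.const_mul (M * B)).mono' ((hUm.mul
        hW.aestronglyMeasurable).mul hφ.continuous.aestronglyMeasurable)
        (Eventually.of_forall fun ξ => h0 _ _ _ (hB ξ))
    · have h1 : deriv h (mollify (ρ n) U ξ) * mollify (ρ n) W ξ * φ ξ - deriv h (U ξ) * W ξ * φ ξ =
          deriv h (mollify (ρ n) U ξ) * (mollify (ρ n) W ξ - W ξ) * φ ξ +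
          (deriv h (mollify (ρ n) U ξ) - deriv h (U ξ)) * W ξ * φ ξ := by ring
      rw [h1]
      refine (abs_add_le _ _).trans (add_le_add (h0 _ _ _ (hB ξ)) ?_)
      rw [abs_mul, abs_mul, mul_comm]
      exact mul_le_mul_of_nonneg_right (hB ξ) (by positivity)
    · have h1 : Tendsto (fun n => ∫ ξ, B * (|deriv h (mollify (ρ n) U ξ) - deriv h (U ξ)| * |W ξ|))
          atTop (𝓝 (∫ _ : EuclideanSpace ℝ (Fin d), (0 : ℝ))) := by
        refine tendsto_integral_of_dominated_convergence (fun ξ => B * (2 * M * |W ξ|))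
          (fun n => (hint n).aestronglyMeasurable) ((hW.abs.const_mul _).const_mul _)
          (fun n => Eventually.of_forall fun ξ => ?_) ?_
        · rw [Real.norm_of_nonneg (by positivity)]
          gcongr
          exact hbd _ _
        · filter_upwards [ContDiffBump.ae_convolution_tendsto_right_of_locallyIntegrable hρ
            (Eventually.of_forall hρK) hU.locallyIntegrable] with ξ hξ
          have h2 := ((((hh'.tendsto (U ξ)).comp hξ).sub_const (deriv h (U ξ))).abs.mul_const
            |W ξ|).const_mul B
          simpa [mollify, Function.comp_def] using h2
      have h2 := ((tendsto_integral_abs_mollify_sub hρ hρK hW).const_mul (M * B)).add h1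
      simp only [mul_zero, integral_zero, add_zero] at h2
      refine h2.congr fun n => ?_
      rw [← integral_const_mul]
      exact (integral_add (((hWn n).sub hW).abs.const_mul _) (hint n)).symm
  have hlim : ∫ ξ, h (U ξ) * fderiv ℝ φ ξ e = -∫ ξ, deriv h (U ξ) * W ξ * φ ξ :=
    tendsto_nhds_unique hL (by simpa only [hparts] using hR.neg)
  have h1 : ∫ ξ in O, v ξ * fderiv ℝ φ ξ e = ∫ ξ, h (U ξ) * fderiv ℝ φ ξ e := by
    rw [← setIntegral_mul_test ((tsupport_fderiv_apply_subset ℝ e).trans hφO)]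
    refine integral_congr_ae ?_
    filter_upwards [hv, ae_restrict_mem hO.isOpen.measurableSet] with ξ hξ hξO
    rw [hξ, hUdef, Set.indicator_of_mem hξO]
  have h2 : ∫ ξ in O, z i ξ * φ ξ = ∫ ξ, deriv h (U ξ) * W ξ * φ ξ := by
    rw [← setIntegral_mul_test hφO]
    refine integral_congr_ae ?_
    filter_upwards [hz i, ae_restrict_mem hO.isOpen.measurableSet] with ξ hξ hξO
    rw [hξ, hUdef, hWdef, Set.indicator_of_mem hξO, Set.indicator_of_mem hξO]
  rw [h1, h2, hlim]

end ChainRule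

/-! ### Truncations and convex functions of one variable -/

section Scalar

/-- Smooth monotone truncations of the identity. -/
theorem exists_truncation : ∃ θ : ℕ → ℝ → ℝ, (∀ n, ContDiff ℝ 1 (θ n)) ∧ (∀ n, Monotone (θ n)) ∧
    (∀ n s, |θ n s| ≤ |s|) ∧ (∀ n, ∃ R, ∀ s, |θ n s| ≤ R) ∧ (∀ n s, |deriv (θ n) s| ≤ 1) ∧
    ∀ s, Tendsto (fun n => θ n s) atTop (𝓝 s) := by
  have hN : ∀ n : ℕ, 0 < (n : ℝ) + 1 := fun n => by positivity
  have hd : ∀ (n : ℕ) s, HasDerivAt (fun s => ((n : ℝ) + 1) * Real.arctan (s / (n + 1)))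
      (1 + (s / (n + 1)) ^ 2)⁻¹ s := fun n s => by
    refine (((Real.hasDerivAt_arctan' (s / (n + 1))).comp s
      ((hasDerivAt_id s).div_const ((n : ℝ) + 1))).const_mul ((n : ℝ) + 1)).congr_deriv ?_
    have := (hN n).ne'
    field_simp
  have hd1 : ∀ (n : ℕ) s, |deriv (fun s => ((n : ℝ) + 1) * Real.arctan (s / (n + 1))) s| ≤ 1 := by
    intro n s
    rw [(hd n s).deriv, abs_of_nonneg (by positivity)]
    exact inv_le_one_of_one_le₀ (by nlinarith [sq_nonneg (s / (n + 1))])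
  refine ⟨fun n s => (n + 1) * Real.arctan (s / (n + 1)), fun n => ?_, fun n => ?_, fun n s => ?_,
    fun n => ⟨(n + 1) * (Real.pi / 2), fun s => ?_⟩, hd1, fun s => ?_⟩
  · exact contDiff_const.mul (Real.contDiff_arctan.comp (contDiff_id.div_const _))
  · intro s t hst
    have := (hN n).le
    dsimp only
    gcongr
  · have := convex_univ.norm_image_sub_le_of_norm_deriv_le
      (fun s _ => (hd n s).differentiableAt) (fun s _ => hd1 n s) (Set.mem_univ 0) (Set.mem_univ s)
    simpa using this
  · rw [abs_mul, abs_of_pos (hN n)]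
    gcongr
    exact abs_le.2 ⟨(Real.neg_pi_div_two_lt_arctan _).le, (Real.arctan_lt_pi_div_two _).le⟩
  -- With `r = 1 / (n + 1)`, the truncation at `s` is the difference quotient at `0` of `r ↦ arctan
  -- (r s)`, whose derivative there is `s`.
  · have h1 : HasDerivAt (fun r : ℝ => Real.arctan (r * s)) s 0 := by
      have h2 : HasDerivAt (fun r : ℝ => r * s) s 0 := by
        simpa using (hasDerivAt_id (0 : ℝ)).mul_const s
      simpa [Function.comp_def] using (Real.hasDerivAt_arctan' (0 * s)).comp (0 : ℝ) h2
    have h3 := h1.tendsto_slope_zero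
    have h4 : Tendsto (fun n : ℕ => 1 / ((n : ℝ) + 1)) atTop (𝓝[≠] 0) :=
      tendsto_nhdsWithin_iff.2 ⟨tendsto_one_div_add_atTop_nhds_zero_nat,
        Eventually.of_forall fun n => (by positivity : 1 / ((n : ℝ) + 1) ≠ 0)⟩
    refine (h3.comp h4).congr fun n => ?_
    simp [div_eq_inv_mul]

variable {g : ℝ → ℝ}

theorem HasQuadraticGrowth.exists_bounds (h : HasQuadraticGrowth g) (hg : Continuous g) :
    (∃ K, 0 ≤ K ∧ ∀ s, |g s| ≤ K * (1 + s ^ 2)) ∧ ∃ c K, 0 < c ∧ ∀ s, c * s ^ 2 - K ≤ g s := by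
  obtain ⟨c, C, R, hc, hR⟩ := h
  obtain ⟨B, hB⟩ := (isCompact_Icc (a := -R) (b := R)).exists_bound_of_continuousOn hg.continuousOn
  have hB' : ∀ s, |s| ≤ R → |g s| ≤ |B| := fun s hs => (hB s (abs_le.1 hs)).trans (le_abs_self B)
  refine ⟨⟨|B| + |C|, by positivity, fun s => ?_⟩, c, |B| + c * R ^ 2, hc, fun s => ?_⟩
  · rcases le_total |s| R with hs | hs
    · have := hB' s hs
      nlinarith [abs_nonneg B, abs_nonneg C, sq_nonneg s,
        mul_nonneg (abs_nonneg B) (sq_nonneg s), mul_nonneg (abs_nonneg C) (sq_nonneg s)]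
    · obtain ⟨h1, h2⟩ := hR s hs
      rw [abs_of_nonneg ((by positivity : 0 ≤ c * s ^ 2).trans h1)]
      nlinarith [abs_nonneg B, abs_nonneg C, mul_nonneg (abs_nonneg B) (sq_nonneg s),
        mul_le_mul_of_nonneg_right (le_abs_self C) (sq_nonneg s)]
  · rcases le_total |s| R with hs | hs
    · have h1 := (abs_le.1 (hB' s hs)).1
      have h2 : s ^ 2 ≤ R ^ 2 := sq_le_sq' (abs_le.1 hs).1 (abs_le.1 hs).2
      nlinarith
    · have h1 := (hR s hs).1
      nlinarith [abs_nonneg B, mul_nonneg hc.le (sq_nonneg R)]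

theorem add_deriv_mul_sub_le (hconv : ConvexOn ℝ Set.univ g) (hg : Differentiable ℝ g) (s t : ℝ) :
    g s + deriv g s * (t - s) ≤ g t := by
  rcases lt_trichotomy s t with h | rfl | h
  · have := hconv.deriv_le_slope (Set.mem_univ s) (Set.mem_univ t) h (hg s)
    rw [slope_def_field, le_div_iff₀ (sub_pos.2 h)] at this
    linarith
  · simp
  · have := hconv.slope_le_deriv (Set.mem_univ t) (Set.mem_univ s) h (hg s)
    rw [slope_def_field, div_le_iff₀ (sub_pos.2 h)] at this
    linarith

/-- The tangent line at `s`, tested at distance `1 + |s|` on either side, bounds the slope by a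
quadratic quantity divided by `1 + |s|`. -/
theorem abs_deriv_le_of_convexOn (hconv : ConvexOn ℝ Set.univ g) (hg : Differentiable ℝ g) {K : ℝ}
    (hK : 0 ≤ K) (h : ∀ s, |g s| ≤ K * (1 + s ^ 2)) (s : ℝ) :
    |deriv g s| ≤ 8 * K * (1 + |s|) := by
  have hp : 0 < 1 + |s| := by positivity
  have key : ∀ t, |t| = 1 + |s| → deriv g s * t ≤ 8 * K * (1 + |s|) * (1 + |s|) := by
    intro t ht
    have h1 := add_deriv_mul_sub_le hconv hg s (s + t)
    have h2 := (abs_le.1 (h s)).1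
    have h3 := (abs_le.1 (h (s + t))).2
    have h4 : (s + t) ^ 2 ≤ (1 + 2 * |s|) ^ 2 := by
      rw [← sq_abs (s + t)]
      gcongr
      linarith [abs_add_le s t]
    have h5 : 1 + s ^ 2 + (1 + (s + t) ^ 2) ≤ 8 * (1 + |s|) * (1 + |s|) := by
      nlinarith [sq_abs s, abs_nonneg s, sq_nonneg |s|]
    have h6 := mul_le_mul_of_nonneg_left h5 hK
    rw [add_sub_cancel_left] at h1
    nlinarith
  have h1 := key (1 + |s|) (abs_of_pos hp)
  have h2 := key (-(1 + |s|)) (by rw [abs_neg, abs_of_pos hp])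
  rw [abs_le]
  constructor
  · have : -deriv g s * (1 + |s|) ≤ 8 * K * (1 + |s|) * (1 + |s|) := by linarith
    linarith [le_of_mul_le_mul_right this hp]
  · exact le_of_mul_le_mul_right h1 hp

theorem monotone_deriv_of_convexOn (hconv : ConvexOn ℝ Set.univ g) (hg : Differentiable ℝ g) :
    Monotone (deriv g) := by
  intro s t hst
  rcases hst.eq_or_lt with rfl | h
  · exact le_rfl
  · have h1 := add_deriv_mul_sub_le hconv hg s t
    have h2 := add_deriv_mul_sub_le hconv hg t s
    exact le_of_mul_le_mul_right (by linarith : deriv g s * (t - s) ≤ deriv g t * (t - s))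
      (sub_pos.2 h)

end Scalar

/-! ### The inequality `∫ g'(u) A u ≤ 0` -/

section Dissipation

variable {d : ℕ} {O : Set (EuclideanSpace ℝ (Fin d))}
  {a : EuclideanSpace ℝ (Fin d) → Matrix (Fin d) (Fin d) ℝ}

theorem isFiniteMeasure_restrict_of_isBoundedDomain (hO : IsBoundedDomain O) :
    IsFiniteMeasure ((volume : Measure (EuclideanSpace ℝ (Fin d))).restrict O) :=
  isFiniteMeasure_restrict.2 hO.isBounded.measure_lt_top.ne

/-- `∫ h(u) A u ≤ 0` for nondecreasing `h` of class `C¹` with bounded derivative. -/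
theorem IsConormalRealization.integral_mul_comp_nonpos (hO : IsBoundedDomain O)
    (ha : IsEllipticCoefficient O a) {u k : L2 O} (huk : IsConormalRealization a u k) {h : ℝ → ℝ}
    (hh : ContDiff ℝ 1 h) (hmono : Monotone h) {M : ℝ} (hM : ∀ s, |deriv h s| ≤ M) :
    ∫ ξ in O, k ξ * h (u ξ) ≤ 0 := by
  have := isFiniteMeasure_restrict_of_isBoundedDomain hO
  obtain ⟨w, hw, hform⟩ := huk
  have hlip : ∀ s t, |h s - h t| ≤ M * |s - t| := fun s t =>
    convex_univ.norm_image_sub_le_of_norm_deriv_le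
      (fun s _ => hh.differentiable one_ne_zero s) (fun s _ => hM s) (Set.mem_univ t)
      (Set.mem_univ s)
  have hv : MemLp (fun ξ => h (u ξ)) 2 (volume.restrict O) := by
    have h1 : MemLp (fun ξ => h (u ξ) - h 0) 2 (volume.restrict O) :=
      (Lp.memLp u).of_le_mul (c := M) ((hh.continuous.comp_aestronglyMeasurable
        (Lp.aestronglyMeasurable u)).sub aestronglyMeasurable_const)
        (Eventually.of_forall fun ξ => by simpa using hlip (u ξ) 0)
    exact (h1.add (memLp_const (h 0))).ae_eq (Eventually.of_forall fun ξ => by simp)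
  have hz : ∀ i, MemLp (fun ξ => deriv h (u ξ) * w i ξ) 2 (volume.restrict O) := fun i =>
    (Lp.memLp (w i)).of_le_mul (c := M) (((hh.continuous_deriv le_rfl).comp_aestronglyMeasurable
      (Lp.aestronglyMeasurable u)).mul (Lp.aestronglyMeasurable (w i)))
      (Eventually.of_forall fun ξ => by
        rw [norm_mul]
        exact mul_le_mul_of_nonneg_right (hM _) (norm_nonneg _))
  -- This makes `h(u)` admissible in the weak formulation; the form then becomes `∫ h'(u) ⟨a ∇u,
  -- ∇u⟩`, which is nonnegative by ellipticity and monotonicity.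
  have hweak : IsWeakGradient (hv.toLp _ : L2 O) fun i => (hz i).toLp _ :=
    hw.comp hO hh hM hv.coeFn_toLp fun i => (hz i).coeFn_toLp
  have h1 := hform _ _ hweak
  have h2 : ∫ ξ in O, k ξ * hv.toLp _ ξ = ∫ ξ in O, k ξ * h (u ξ) := by
    refine integral_congr_ae ?_
    filter_upwards [hv.coeFn_toLp] with ξ hξ
    rw [hξ]
  rw [h2] at h1
  rw [← neg_nonneg, ← h1]
  refine integral_nonneg_of_ae ?_
  obtain ⟨a₀, ha₀, hell⟩ := ha.elliptic
  have hz' := ae_all_iff.2 fun i => (hz i).coeFn_toLp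
  filter_upwards [hz', ae_restrict_mem hO.isOpen.measurableSet] with ξ hξ hξO
  have h3 := hell ξ (subset_closure hξO) fun i => w i ξ
  have h4 : 0 ≤ ∑ i, ∑ j, a ξ i j * w i ξ * w j ξ :=
    (mul_nonneg ha₀.le (Finset.sum_nonneg fun i _ => sq_nonneg (w i ξ))).trans h3
  have h5 : ∑ i, ∑ j, a ξ i j * w j ξ * (hz i).toLp _ ξ =
      deriv h (u ξ) * ∑ i, ∑ j, a ξ i j * w i ξ * w j ξ := by
    rw [Finset.mul_sum]
    refine Finset.sum_congr rfl fun i _ => ?_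
    rw [Finset.mul_sum]
    refine Finset.sum_congr rfl fun j _ => ?_
    rw [hξ i]
    ring
  rw [Pi.zero_apply, h5]
  exact mul_nonneg hmono.deriv_nonneg h4

theorem integrable_one_add_abs_mul (hO : IsBoundedDomain O) (u k : L2 O) :
    Integrable (fun ξ => (1 + |u ξ|) * |k ξ|) (volume.restrict O) := by
  have := isFiniteMeasure_restrict_of_isBoundedDomain hO
  have h1 : Integrable (fun ξ => |k ξ|) (volume.restrict O) :=
    ((Lp.memLp k).integrable one_le_two).abs
  refine (h1.add (L2_integrable_mul u k).abs).congr (Eventually.of_forall fun ξ => ?_)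
  simp only [Pi.add_apply, abs_mul]
  ring

variable {g : ℝ → ℝ}

/-- `∫ g'(u) A u ≤ 0` for convex `g` of class `C²` and quadratic growth. -/
theorem IsConormalRealization.integral_mul_deriv_nonpos (hO : IsBoundedDomain O)
    (ha : IsEllipticCoefficient O a) (hg : ContDiff ℝ 2 g) (hconv : ConvexOn ℝ Set.univ g) {K : ℝ}
    (hK : 0 ≤ K) (hgK : ∀ s, |g s| ≤ K * (1 + s ^ 2)) {u k : L2 O}
    (huk : IsConormalRealization a u k) :
    Integrable (fun ξ => k ξ * deriv g (u ξ)) (volume.restrict O) ∧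
      ∫ ξ in O, k ξ * deriv g (u ξ) ≤ 0 := by
  have hgd : Differentiable ℝ g := hg.differentiable two_ne_zero
  have hg' : ContDiff ℝ 1 (deriv g) := (contDiff_succ_iff_deriv (n := 1)).1 hg |>.2.2
  have hder := abs_deriv_le_of_convexOn hconv hgd hK hgK
  obtain ⟨θ, hθ, hθm, hθs, hθb, hθd, hθlim⟩ := exists_truncation
  have hint := (integrable_one_add_abs_mul hO u k).const_mul (8 * K)
  have hmeas : ∀ f : ℝ → ℝ, Continuous f →
      AEStronglyMeasurable (fun ξ => k ξ * f (u ξ)) (volume.restrict O) := fun f hf =>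
    (Lp.aestronglyMeasurable k).mul (hf.comp_aestronglyMeasurable (Lp.aestronglyMeasurable u))
  have hbound : ∀ (x s t : ℝ), |t| ≤ |s| → ‖x * deriv g t‖ ≤ 8 * K * ((1 + |s|) * |x|) :=
    fun x s t hst => by
      rw [norm_mul, mul_comm, ← mul_assoc]
      refine mul_le_mul_of_nonneg_right ((hder t).trans ?_) (abs_nonneg x)
      gcongr
  refine ⟨hint.mono' (hmeas _ hg'.continuous) (Eventually.of_forall fun ξ => hbound _ _ _ le_rfl), ?_⟩
  have hlim : Tendsto (fun n => ∫ ξ in O, k ξ * deriv g (θ n (u ξ))) atTop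
      (𝓝 (∫ ξ in O, k ξ * deriv g (u ξ))) := by
    refine tendsto_integral_of_dominated_convergence _
      (fun n => hmeas _ (hg'.continuous.comp (hθ n).continuous)) hint
      (fun n => Eventually.of_forall fun ξ => hbound _ _ _ (hθs n _))
      (Eventually.of_forall fun ξ => ?_)
    exact ((hg'.continuous.tendsto _).comp (hθlim (u ξ))).const_mul _
  refine le_of_tendsto' hlim fun n => ?_
  obtain ⟨R, hR⟩ := hθb n
  obtain ⟨M, hM⟩ := (isCompact_Icc (a := -R) (b := R)).exists_bound_of_continuousOn
    (hg'.continuous_deriv le_rfl).continuousOn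
  -- Since `θ n` takes values in `[-R, R]`, only the values of `g''` on this compact interval enter
  -- the derivative of `g' ∘ θ n`.
  refine huk.integral_mul_comp_nonpos hO ha (hg'.comp (hθ n))
    ((monotone_deriv_of_convexOn hconv hgd).comp (hθm n)) (M := M) fun s => ?_
  rw [deriv_comp s (hg'.differentiable one_ne_zero _) ((hθ n).differentiable one_ne_zero _),
    abs_mul]
  have h1 := hM (θ n s) (abs_le.1 (hR s))
  rw [Real.norm_eq_abs] at h1
  calc _ ≤ |deriv (deriv g) (θ n s)| * 1 := by gcongr; exact hθd n s
    _ ≤ M := by rwa [mul_one]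

end Dissipation

/-! ### The energy `G`: convexity, continuity, Jensen, resolvent bound -/

section Functional

variable {d : ℕ} {O : Set (EuclideanSpace ℝ (Fin d))}
  {a : EuclideanSpace ℝ (Fin d) → Matrix (Fin d) (Fin d) ℝ} {g : ℝ → ℝ}

variable (O g) in
/-- The functional `G x = ∫ g(x(ξ)) dξ`. -/
noncomputable def convexEnergy (x : L2 O) : ℝ := ∫ ξ in O, g (x ξ)

theorem integrable_one_add_sq (hO : IsBoundedDomain O) (x : L2 O) :
    Integrable (fun ξ => 1 + x ξ ^ 2) (volume.restrict O) :=
  have := isFiniteMeasure_restrict_of_isBoundedDomain hO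
  (integrable_const 1).add (L2_integrable_sq x)

theorem integral_one_add_sq (hO : IsBoundedDomain O) (x : L2 O) :
    ∫ ξ in O, (1 + x ξ ^ 2) = volume.real O + ‖x‖ ^ 2 := by
  have := isFiniteMeasure_restrict_of_isBoundedDomain hO
  rw [integral_add (integrable_const 1) (L2_integrable_sq x), L2_norm_sq_eq]
  simp

theorem integrable_comp_of_quadratic (hO : IsBoundedDomain O) (hg : Continuous g) {K : ℝ}
    (hgK : ∀ s, |g s| ≤ K * (1 + s ^ 2)) (x : L2 O) :
    Integrable (fun ξ => g (x ξ)) (volume.restrict O) :=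
  ((integrable_one_add_sq hO x).const_mul K).mono'
    (hg.comp_aestronglyMeasurable (Lp.aestronglyMeasurable x))
    (Eventually.of_forall fun _ => hgK _)

theorem convexEnergy_eq_of_ae_const (hO : IsBoundedDomain O) {x : L2 O} {s : ℝ}
    (hx : x =ᵐ[volume.restrict O] fun _ => s) : convexEnergy O g x = g s * volume.real O := by
  have := isFiniteMeasure_restrict_of_isBoundedDomain hO
  have h1 : convexEnergy O g x = ∫ _ in O, g s := by
    refine integral_congr_ae ?_
    filter_upwards [hx] with ξ hξ
    rw [hξ]
  rw [h1]
  simp [mul_comm]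

theorem convexOn_convexEnergy (hconv : ConvexOn ℝ Set.univ g)
    (hint : ∀ x : L2 O, Integrable (fun ξ => g (x ξ)) (volume.restrict O)) :
    ConvexOn ℝ Set.univ (convexEnergy O g) := by
  refine ⟨convex_univ, fun x _ y _ s t hs ht hst => ?_⟩
  rw [convexEnergy, convexEnergy, convexEnergy, smul_eq_mul, smul_eq_mul, ← integral_const_mul,
    ← integral_const_mul, ← integral_add ((hint x).const_mul s) ((hint y).const_mul t)]
  refine integral_mono_ae (hint _) (((hint x).const_mul s).add ((hint y).const_mul t)) ?_
  filter_upwards [Lp.coeFn_add (s • x) (t • y), Lp.coeFn_smul s x, Lp.coeFn_smul t y]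
    with ξ h1 h2 h3
  rw [h1, Pi.add_apply, h2, h3]
  exact hconv.2 (Set.mem_univ _) (Set.mem_univ _) hs ht hst

/-- A convex function on a normed space that is bounded above near one point is continuous; the
quadratic upper bound on `g` supplies this on the unit ball. -/
theorem continuous_convexEnergy (hO : IsBoundedDomain O) (hg : Continuous g)
    (hconv : ConvexOn ℝ Set.univ g) {K : ℝ} (hK : 0 ≤ K)
    (hgK : ∀ s, |g s| ≤ K * (1 + s ^ 2)) : Continuous (convexEnergy O g) := by
  have hint := integrable_comp_of_quadratic hO hg hgK
  rw [← continuousOn_univ]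
  have htfae := ((convexOn_convexEnergy hconv hint).continuousOn_tfae isOpen_univ
    Set.univ_nonempty).out 3 1
  refine htfae.1 ⟨0, Set.mem_univ _, K * (volume.real O + 1), ?_⟩
  rw [eventually_map]
  filter_upwards [Metric.ball_mem_nhds (0 : L2 O) one_pos] with x hx
  rw [mem_ball_zero_iff] at hx
  have h1 : convexEnergy O g x ≤ K * (volume.real O + ‖x‖ ^ 2) := by
    rw [← integral_one_add_sq hO, ← integral_const_mul]
    exact integral_mono (hint x) ((integrable_one_add_sq hO x).const_mul K)
      fun ξ => (le_abs_self _).trans (hgK _)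
  refine h1.trans ?_
  gcongr
  exact pow_le_one₀ (norm_nonneg x) hx.le

theorem isBounded_sublevelDomain (hO : IsBoundedDomain O)
    (hint : ∀ x : L2 O, Integrable (fun ξ => g (x ξ)) (volume.restrict O)) {c K : ℝ} (hc : 0 < c)
    (hgc : ∀ s, c * s ^ 2 - K ≤ g s) (r : ℝ) : Bornology.IsBounded (sublevelDomain O g r) := by
  have := isFiniteMeasure_restrict_of_isBoundedDomain hO
  rw [isBounded_iff_forall_norm_le]
  refine ⟨√((r + K * volume.real O) / c), fun x hx => ?_⟩
  have h1 : ∫ ξ in O, (c * x ξ ^ 2 - K) = c * ‖x‖ ^ 2 - K * volume.real O := by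
    rw [integral_sub ((L2_integrable_sq x).const_mul c) (integrable_const K), integral_const_mul,
      L2_norm_sq_eq]
    simp [mul_comm]
  have h2 : ∫ ξ in O, (c * x ξ ^ 2 - K) ≤ ∫ ξ in O, g (x ξ) :=
    integral_mono (((L2_integrable_sq x).const_mul c).sub (integrable_const K)) (hint x)
      fun ξ => hgc _
  have h3 : ∫ ξ in O, g (x ξ) < r := hx
  refine Real.le_sqrt_of_sq_le ?_
  rw [le_div_iff₀ hc]
  linarith

/-- Jensen's inequality for the spatial average. -/
theorem map_average_le_convexEnergy (hO : IsBoundedDomain O) (hconv : ConvexOn ℝ Set.univ g)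
    (hg : Continuous g) (hint : ∀ x : L2 O, Integrable (fun ξ => g (x ξ)) (volume.restrict O))
    (x : L2 O) : g (average x) * volume.real O ≤ convexEnergy O g x := by
  have := isFiniteMeasure_restrict_of_isBoundedDomain hO
  have hpos : 0 < volume O := hO.isOpen.measure_pos volume hO.isConnected.nonempty
  have hne : NeZero ((volume : Measure (EuclideanSpace ℝ (Fin d))).restrict O) :=
    ⟨by rw [Ne, Measure.restrict_eq_zero]; exact hpos.ne'⟩
  have h1 := hconv.map_average_le hg.continuousOn isClosed_univ
    (Eventually.of_forall fun ξ => Set.mem_univ (x ξ)) ((Lp.memLp x).integrable one_le_two) (hint x)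
  have h2 : average x = ⨍ ξ in O, x ξ := by
    rw [average, invMeasure, MeasureTheory.average, Measure.restrict_apply_univ]
  have hpos' : 0 < volume.real O := ENNReal.toReal_pos hpos.ne' hO.isBounded.measure_lt_top.ne
  rw [h2]
  calc _ ≤ (⨍ ξ in O, g (x ξ)) * volume.real O := by gcongr
    _ = convexEnergy O g x := by
      rw [setAverage_eq, smul_eq_mul, convexEnergy]
      field_simp

/-- The resolvent of the conormal realization does not increase the energy. -/
theorem IsConormalRealization.convexEnergy_le (hO : IsBoundedDomain O)
    (ha : IsEllipticCoefficient O a) (hg : ContDiff ℝ 2 g) (hconv : ConvexOn ℝ Set.univ g) {K : ℝ}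
    (hK : 0 ≤ K) (hgK : ∀ s, |g s| ≤ K * (1 + s ^ 2)) {u k : L2 O}
    (huk : IsConormalRealization a u k) {ε : ℝ} (hε : 0 ≤ ε) :
    convexEnergy O g u ≤ convexEnergy O g (u - ε • k) := by
  have hint := integrable_comp_of_quadratic hO hg.continuous hgK
  obtain ⟨h1, h2⟩ := huk.integral_mul_deriv_nonpos hO ha hg hconv hK hgK
  have h3 : ∫ ξ in O, (g (u ξ) - ε * (k ξ * deriv g (u ξ))) ≤ convexEnergy O g (u - ε • k) := by
    refine integral_mono_ae ((hint u).sub (h1.const_mul ε)) (hint _) ?_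
    filter_upwards [Lp.coeFn_sub u (ε • k), Lp.coeFn_smul ε k] with ξ h4 h5
    rw [h4, Pi.sub_apply, h5, Pi.smul_apply, smul_eq_mul]
    have := add_deriv_mul_sub_le hconv (hg.differentiable two_ne_zero) (u ξ) (u ξ - ε * k ξ)
    linarith
  rw [integral_sub (hint u) (h1.const_mul ε), integral_const_mul] at h3
  have : convexEnergy O g u = ∫ ξ in O, g (u ξ) := rfl
  nlinarith

end Functional

/-! ### Assembly of the semigroup and the exit domain -/

section Main

variable {d : ℕ} {O : Set (EuclideanSpace ℝ (Fin d))}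
  {a : EuclideanSpace ℝ (Fin d) → Matrix (Fin d) (Fin d) ℝ}

/-- The conormal realization generates exactly one strongly continuous semigroup, which leaves
invariant every closed convex set that is invariant under the resolvents. -/
theorem exists_unique_semigroup (hO : IsBoundedDomain O) (ha : IsEllipticCoefficient O a) :
    ∃ S : ℝ≥0 → L2 O →L[ℝ] L2 O, IsSemigroupOf a S ∧ (∀ T, IsSemigroupOf a T → T = S) ∧
      ∀ C : Set (L2 O), Convex ℝ C → IsClosed C →
        (∀ u k, IsConormalRealization a u k → ∀ ε : ℝ, 0 < ε → u - ε • k ∈ C → u ∈ C) →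
        ∀ t, ∀ x ∈ C, S t x ∈ C := by
  obtain ⟨Γ, hΓ, hΓa⟩ := exists_isMaximalDissipative_conormal hO ha
  obtain ⟨S, hS, hSle, hSΓ, hinv⟩ := exists_semigroup_of_isMaximalDissipative hΓ
  have hgen := inGeneratorGraph_iff_mem hΓ hSle hSΓ
  refine ⟨S, ⟨hS, fun u f => (hgen u f).trans (hΓa u f)⟩, fun T hT => ?_, fun C hC hC' h => ?_⟩
  · exact hT.1.eq_of_generator hΓ hS (fun u f => (hT.2 u f).trans (hΓa u f).symm) hgen
  · exact hinv C hC hC' fun p hp => h p.1 p.2 ((hΓa _ _).1 hp)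

end Main

end NeumannExit

theorem lemma5p2 {d : ℕ} (hd : 1 ≤ d) (O : Set (EuclideanSpace ℝ (Fin d)))
    (hO : NeumannExit.IsBoundedDomain O) (hbd : NeumannExit.HasSmoothBoundary O)
    (a : EuclideanSpace ℝ (Fin d) → Matrix (Fin d) (Fin d) ℝ)
    (ha : NeumannExit.IsEllipticCoefficient O a)
    (g : ℝ → ℝ) (hg : ContDiff ℝ 2 g) (hconv : ConvexOn ℝ Set.univ g)
    (hgrowth : NeumannExit.HasQuadraticGrowth g) :
    (∃! S : ℝ≥0 → NeumannExit.L2 O →L[ℝ] NeumannExit.L2 O, NeumannExit.IsSemigroupOf a S) ∧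
    (∀ x : NeumannExit.L2 O, IntegrableOn (fun ξ => g (x ξ)) O volume) ∧
    ∀ S : ℝ≥0 → NeumannExit.L2 O →L[ℝ] NeumannExit.L2 O, NeumannExit.IsSemigroupOf a S →
      ∀ r : ℝ, g 0 * volume.real O < r →
        Convex ℝ (NeumannExit.sublevelDomain O g r) ∧
        NeumannExit.IsExitDomain S (NeumannExit.sublevelDomain O g r) := by
  obtain ⟨⟨K, hK, hgK⟩, c, K', hc, hgc⟩ := hgrowth.exists_bounds hg.continuous
  have hint := NeumannExit.integrable_comp_of_quadratic hO hg.continuous hgK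
  have hGconv := NeumannExit.convexOn_convexEnergy hconv hint
  have hGcont := NeumannExit.continuous_convexEnergy hO hg.continuous hconv hK hgK
  obtain ⟨S₀, hS₀, huniq, hinv⟩ := NeumannExit.exists_unique_semigroup hO ha
  refine ⟨⟨S₀, hS₀, huniq⟩, hint, fun S hS r hr => ?_⟩
  obtain rfl := huniq S hS
  have hmem : ∀ x, x ∈ NeumannExit.sublevelDomain O g r ↔ NeumannExit.convexEnergy O g x < r :=
    fun _ => Iff.rfl
  have hcvx : Convex ℝ (NeumannExit.sublevelDomain O g r) := by
    have := hGconv.convex_lt r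
    simp only [Set.mem_univ, true_and] at this
    exact this
  have h0 : (0 : NeumannExit.L2 O) ∈ NeumannExit.sublevelDomain O g r := by
    rw [hmem, NeumannExit.convexEnergy_eq_of_ae_const hO (s := 0) (Lp.coeFn_zero _ _ _)]
    exact hr
  refine ⟨hcvx, isOpen_lt hGcont continuous_const,
    NeumannExit.isBounded_sublevelDomain hO hint hc hgc r, hcvx.isConnected ⟨0, h0⟩, h0,
    fun t x hx => ?_, fun x hx => ?_⟩
  -- The invariance principle needs a closed set, so it is applied to the closed sublevel set at the
  -- level of `x` itself; the strict bound by `r` is then inherited.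
  · have hle := hinv {y | NeumannExit.convexEnergy O g y ≤ NeumannExit.convexEnergy O g x}
      (by simpa using hGconv.convex_le (NeumannExit.convexEnergy O g x))
      (isClosed_le hGcont continuous_const)
      (fun u k huk ε hε h => (huk.convexEnergy_le hO ha hg hconv hK hgK hε.le).trans h) t x
      (le_refl (NeumannExit.convexEnergy O g x))
    exact (hmem _).2 (lt_of_le_of_lt hle ((hmem x).1 hx))
  · have := NeumannExit.isFiniteMeasure_restrict_of_isBoundedDomain hO
    have hy := (memLp_const (μ := volume.restrict O) (p := 2) (NeumannExit.average x)).coeFn_toLp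
    refine ⟨_, ?_, hy⟩
    rw [hmem, NeumannExit.convexEnergy_eq_of_ae_const hO hy]
    exact (NeumannExit.map_average_le_convexEnergy hO hconv hg.continuous hint x).trans_lt hx
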